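/- Let $\mathcal H$ be a (coassociative, counital) coalgebra over $\mathbb C$, with coproduct written $\Delta(h)=\sum h_0\otimes h_1$. Let $W=W(\mathcal H)$ be the non-unital DG algebra freely generated by symbols $h$ of degree $1$ and $\omega_h$ of degree $2$, linear in $h\in\mathcal H$, whose differential is the (graded) derivation $\partial$ with $$\partial(h)=\omega_h-\sum h_0h_1,\qquad \partial(\omega_h)=\sum\omega_{h_0}h_1-\sum h_0\omega_{h_1}.$$ Write $\partial_0$ for the derivation with $\partial_0(h)=-\sum h_0h_1$ and $\partial_0(\omega_h)=\partial(\omega_h)$. Let $I=I(\mathcal H)$ be the two-sided ideal generated by all $\omega_h$, and $I^0:=W$. For $n\ge 0$ put $I_n=I^{n+1}$ and $W_n=W/I^{n+1}$, and consider the complexes, with graded commutators and the differential induced by $\partial$, $$I_{n,\natural}=I^{n+1}/[I,I^{n}],\qquad W_{n,\natural}=W_n/[W_n,W_n].$$ *Chern–Simons map.* Let $\Omega(1)=\mathbb C[t]\oplus\mathbb C[t]\,dt$ be the algebraic de Rham complex of the line, and form the graded tensor product DG algebra $W\otimes\Omega(1)$, with differential $D$. Let $\varphi(h)=h\otimes t$,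 and let $k\colon W\to W\otimes\Omega(1)$ be the algebra map with $k(h)=\varphi(h)$ and $k(\omega_h)=D\varphi(h)+\sum\varphi(h_0)\varphi(h_1)$. The contraction $H\colon W\to W$, of degree $-1$, is $k$ followed by $\mathrm{id}\otimes\int_0^1$, that is $x\otimes t^j\mapsto 0$ and $x\otimes t^j\,dt\mapsto(-1)^{|x|}\frac{x}{j+1}$. The Chern–Simons map $CS\colon H^*(I_{n,\natural})\to H^{*-1}(W_{n,\natural})$ is $[x]\mapsto[H(x)]$. *$S$-operators.* For a generator $a$ ($a=h$ or $a=\omega_h$) put $t(ax)=(-1)^{|a||x|}xa$ and $b(ax)=\partial(ax)+t(\partial_0(a)x)$, and put $N=1+t+\dots+t^{p-1}$ on products of $p$ generators. For $R=I_n$ or $R=W_n$, the first quadrant cyclic bicomplex of $R$ has the columns $$(R,b)\xrightarrow{\,t-1\,}(R,-\partial)\xrightarrow{\,N\,}(R,b)\xrightarrow{\,t-1\,}(R,-\partial)\xrightarrow{\,N\,}\cdots$$ in positions $0,1,2,3,\dots$, with total differential the sum of the vertical and the horizontal ones. The map $N\colon R_\natural\to(R,b)$ into column $0$ induces an isomorphism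 from $H^*(R_\natural)$ onto the cohomology of the total complex, and $S\colon H^*(R_\natural)\to H^{*+2}(R_\natural)$ is the operator corresponding under it to the shift of the bicomplex by two columns. **Theorem.** For every $n\ge0$ and every integer $k$, the map $CS$ is well defined and is an isomorphism $$CS\colon H^k(I_{n,\natural})\xrightarrow{\ \cong\ }H^{k-1}(W_{n,\natural}).$$ Moreover the operators $S$ on $H^*(I_{n,\natural})$ and on $H^*(W_{n,\natural})$ are well defined (in particular, $N$ induces the isomorphisms described above), and $CS\circ S=S\circ CS$. -/

import Mathlib

open scoped TensorProduct

noncomputable section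

namespace NCWeil

/-! ### Cohomology of a quotient complex of a graded vector space -/

section Cohomology

variable {X Y : Type*} [AddCommGroup X] [Module ℂ X] [AddCommGroup Y] [Module ℂ Y]

/-- Degree `k` cocycles of the quotient complex `A / B` (with the differential induced by `D`),
as elements of `A k`: those `x ∈ A k` with `D x ∈ B (k + 1)`. -/
def cocycles (D : X →ₗ[ℂ] X) (A B : ℤ → Submodule ℂ X) (k : ℤ) : Submodule ℂ X :=
  A k ⊓ (B (k + 1)).comap D

/-- Representatives in `A k` of the degree `k` coboundaries of the quotient complex `A / B`. -/
def coboundaries (D : X →ₗ[ℂ] X) (A B : ℤ → Submodule ℂ X) (k : ℤ) : Submodule ℂ X :=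
  B k ⊔ (A (k - 1)).map D

/-- The cohomology `H^k(A / B)` of the quotient complex `A / B`. -/
abbrev Coh (D : X →ₗ[ℂ] X) (A B : ℤ → Submodule ℂ X) (k : ℤ) : Type _ :=
  ↥(cocycles D A B k) ⧸ (coboundaries D A B k).submoduleOf (cocycles D A B k)

/-- The class of a cocycle. -/
def Coh.cls (D : X →ₗ[ℂ] X) (A B : ℤ → Submodule ℂ X) (k : ℤ) :
    ↥(cocycles D A B k) →ₗ[ℂ] Coh D A B k :=
  ((coboundaries D A B k).submoduleOf (cocycles D A B k)).mkQ

/-- `φ` is the map induced in cohomology by `f`: the map `f` sends cocycles to cocycles and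
`φ [x] = [f x]` for every cocycle `x`. -/
def Induces (D : X →ₗ[ℂ] X) (A B : ℤ → Submodule ℂ X) (k : ℤ)
    (D' : Y →ₗ[ℂ] Y) (A' B' : ℤ → Submodule ℂ Y) (l : ℤ)
    (f : X →ₗ[ℂ] Y) (φ : Coh D A B k →ₗ[ℂ] Coh D' A' B' l) : Prop :=
  ∀ x : ↥(cocycles D A B k), ∃ hy : f x ∈ cocycles D' A' B' l,
    φ (Coh.cls D A B k x) = Coh.cls D' A' B' l ⟨f x, hy⟩

end Cohomology

/-! ### The Weil algebra -/

variable (C : Type*) [AddCommGroup C] [Module ℂ C]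

/-- The unital free algebra on the symbols `h` and `ω_h`, linear in `h ∈ C`: the tensor algebra on
two copies of `C`. The Weil algebra `W(C)` is its augmentation ideal `weil C` below. -/
abbrev T : Type _ := TensorAlgebra ℂ (C × C)

/-- The generator `h`, of degree `1`. -/
def gen : C →ₗ[ℂ] T C := TensorAlgebra.ι ℂ ∘ₗ LinearMap.inl ℂ C C

/-- The generator `ω_h`, of degree `2`. -/
def curv : C →ₗ[ℂ] T C := TensorAlgebra.ι ℂ ∘ₗ LinearMap.inr ℂ C C

/-- A word in the letters `h` (`Sum.inl h`) and `ω_h` (`Sum.inr h`). -/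
def word (l : List (C ⊕ C)) : T C := (l.map (Sum.elim (gen C) (curv C))).prod

/-- The total degree of a word: letters `h` have degree `1`, letters `ω_h` have degree `2`. -/
def wordDeg (l : List (C ⊕ C)) : ℤ := (l.map (Sum.elim (fun _ => (1 : ℤ)) (fun _ => 2))).sum

/-- The (non-unital) Weil algebra `W(C)`, spanned by the non-empty words. -/
def weil : Submodule ℂ (T C) := Submodule.span ℂ {x | ∃ l, l ≠ [] ∧ word C l = x}

/-- The component of degree `k` of `W(C)`. -/
def weilDeg (k : ℤ) : Submodule ℂ (T C) :=
  Submodule.span ℂ {x | ∃ l, l ≠ [] ∧ wordDeg C l = k ∧ word C l = x}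

/-- The graded subspace of `W(C)` with components `P ∩ W(C)^k`. -/
def gr (P : Submodule ℂ (T C)) (k : ℤ) : Submodule ℂ (T C) := P ⊓ weilDeg C k

/-- The two-sided ideal `I(C)` generated by the curvatures `ω_h`. -/
def curvIdeal : Submodule ℂ (T C) := ⊤ * LinearMap.range (curv C) * ⊤

/-- The powers `I(C)^m` in `W(C)`, with `I(C)^0 = W(C)`. -/
def curvPow : ℕ → Submodule ℂ (T C)
  | 0 => weil C
  | m + 1 => curvIdeal C ^ (m + 1)

/-- The span of the graded commutators `[x, y] = x y - (-1)^{|x||y|} y x` of homogeneous elements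
`x ∈ P`, `y ∈ Q`. -/
def gradedComm (P Q : Submodule ℂ (T C)) : Submodule ℂ (T C) :=
  Submodule.span ℂ {z | ∃ i j : ℤ, ∃ x ∈ gr C P i, ∃ y ∈ gr C Q j,
    z = x * y - (((-1 : ℤˣ) ^ (i * j) : ℤˣ) : ℤ) • (y * x)}

/-- The parity automorphism `x ↦ (-1)^{|x|} x`. -/
def parity : T C →ₐ[ℂ] T C :=
  TensorAlgebra.lift ℂ ((-gen C).coprod (curv C))

/-! ### Linear maps on the free algebra defined by recursion on the first letter -/

section Recursion

variable {C}
variable {M : Type*} [AddCommGroup M] [Module ℂ M]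

/-- Left multiplication by a letter `v`, together with the recursion step `F v`. -/
def recStep (F : C × C →ₗ[ℂ] (T C × M) →ₗ[ℂ] M) : C × C →ₗ[ℂ] Module.End ℂ (T C × M) where
  toFun v := (LinearMap.mulLeft ℂ (TensorAlgebra.ι ℂ v) ∘ₗ LinearMap.fst ℂ (T C) M).prod (F v)
  map_add' v w := by
    ext <;> simp [add_mul]
  map_smul' c v := by
    ext <;> simp

/-- The linear map `f` with `f 1 = 0` and `f (v x) = F v (x, f x)` for every letter `v`. -/
def leftRec (F : C × C →ₗ[ℂ] (T C × M) →ₗ[ℂ] M) : T C →ₗ[ℂ] M :=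
  LinearMap.snd ℂ (T C) M ∘ₗ LinearMap.applyₗ ((1, 0) : T C × M) ∘ₗ
    (TensorAlgebra.lift ℂ (recStep F)).toLinearMap

theorem leftRec_one (F : C × C →ₗ[ℂ] (T C × M) →ₗ[ℂ] M) : leftRec F 1 = 0 := by
  simp [leftRec]

theorem lift_recStep_fst (F : C × C →ₗ[ℂ] (T C × M) →ₗ[ℂ] M) (x : T C) (p : T C × M) :
    (TensorAlgebra.lift ℂ (recStep F) x p).1 = x * p.1 := by
  induction x using TensorAlgebra.induction generalizing p with
  | algebraMap r => simp [Algebra.smul_def]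
  | ι v => simp [recStep]
  | mul a b ha hb => simp [ha, hb, mul_assoc]
  | add a b ha hb => simp [ha, hb, add_mul]

theorem leftRec_ι_mul (F : C × C →ₗ[ℂ] (T C × M) →ₗ[ℂ] M) (v : C × C) (x : T C) :
    leftRec F (TensorAlgebra.ι ℂ v * x) = F v (x, leftRec F x) := by
  have h : TensorAlgebra.lift ℂ (recStep F) x (1, 0) = (x, leftRec F x) := by
    ext
    · simp [lift_recStep_fst]
    · simp [leftRec]
  simp only [leftRec, LinearMap.comp_apply, AlgHom.toLinearMap_apply, map_mul,
    LinearMap.applyₗ_apply_apply, Module.End.mul_apply, TensorAlgebra.lift_ι_apply,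
    LinearMap.snd_apply] at h ⊢
  rw [h]
  simp [recStep]

end Recursion

/-! ### The backward cyclic permutation and the norm -/

/-- The graded cyclic permutation `t (a x) = (-1)^{|a||x|} x a`, for `a = h` or `a = ω_h`. -/
def cyc : T C →ₗ[ℂ] T C :=
  leftRec (LinearMap.mk₂ ℂ
    (fun v (p : T C × T C) => parity C p.1 * gen C v.1 + p.1 * curv C v.2)
    (by intros; simp [mul_add]; abel)
    (by intros; simp)
    (by intros; simp [add_mul]; abel)
    (by intros; simp))

theorem cyc_gen_mul (h : C) (x : T C) : cyc C (gen C h * x) = parity C x * gen C h := by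
  simp [cyc, gen, curv, leftRec_ι_mul]

theorem cyc_curv_mul (h : C) (x : T C) : cyc C (curv C h * x) = x * curv C h := by
  simp [cyc, gen, curv, leftRec_ι_mul]

/-- The norm operator, `N = 1 + t + ⋯ + t^{p-1}` on the span of the words with `p` letters. -/
def cycNorm : T C →ₗ[ℂ] T C :=
  DirectSum.toModule ℂ ℕ (T C)
      (fun p => (∑ i ∈ Finset.range p, cyc C ^ i) ∘ₗ
        ((LinearMap.range (TensorAlgebra.ι ℂ : C × C →ₗ[ℂ] T C)) ^ p).subtype) ∘ₗ
    (DirectSum.decomposeLinearEquiv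
      (fun p : ℕ => (LinearMap.range (TensorAlgebra.ι ℂ : C × C →ₗ[ℂ] T C)) ^ p)).toLinearMap

/-! ### The differentials -/

variable [Coalgebra ℂ C]

/-- `h ↦ ∑ f(h_0) g(h_1)`. -/
def conv {C : Type*} [AddCommGroup C] [Module ℂ C] [Coalgebra ℂ C]
    {A : Type*} [Ring A] [Algebra ℂ A] (f g : C →ₗ[ℂ] A) : C →ₗ[ℂ] A :=
  LinearMap.mul' ℂ A ∘ₗ TensorProduct.map f g ∘ₗ Coalgebra.comul

/-- `∂_0` on generators:
`∂_0 h = - ∑ h_0 h_1` and `∂_0 ω_h = ∑ ω_{h_0} h_1 - ∑ h_0 ω_{h_1}`. -/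
def diff0Gen : C × C →ₗ[ℂ] T C :=
  (-conv (gen C) (gen C)).coprod (conv (curv C) (gen C) - conv (gen C) (curv C))

/-- `∂` on generators:
`∂ h = ω_h - ∑ h_0 h_1` and `∂ ω_h = ∑ ω_{h_0} h_1 - ∑ h_0 ω_{h_1}`. -/
def diffGen : C × C →ₗ[ℂ] T C := diff0Gen C + curv C ∘ₗ LinearMap.fst ℂ C C

/-- The differential `∂` of `W(C)`: the derivation (of degree `1`) given by `diffGen` on generators,
`∂ (v x) = ∂ v · x + (-1)^{|v|} v · ∂ x`. -/
def diff : T C →ₗ[ℂ] T C :=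
  leftRec (LinearMap.mk₂ ℂ
    (fun v (p : T C × T C) => diffGen C v * p.1 + parity C (TensorAlgebra.ι ℂ v) * p.2)
    (by intros; simp [add_mul]; abel)
    (by intros; simp)
    (by intros; simp [mul_add]; abel)
    (by intros; simp))

theorem diff_ι_mul (v : C × C) (x : T C) : diff C (TensorAlgebra.ι ℂ v * x) =
    diffGen C v * x + parity C (TensorAlgebra.ι ℂ v) * diff C x := by
  simp [diff, leftRec_ι_mul]

/-- The extra term of the second differential: `b_t (a x) = t (∂_0(a) x)` for `a = h` or `ω_h`. -/
def diffT : T C →ₗ[ℂ] T C :=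
  leftRec (LinearMap.mk₂ ℂ
    (fun v (p : T C × T C) => cyc C (diff0Gen C v * p.1))
    (by intros; simp [add_mul])
    (by intros; simp)
    (by intros; simp [mul_add])
    (by intros; simp))

theorem diffT_ι_mul (v : C × C) (x : T C) :
    diffT C (TensorAlgebra.ι ℂ v * x) = cyc C (diff0Gen C v * x) := by
  simp [diffT, leftRec_ι_mul]

/-- The differential `b = ∂ + b_t` of `W^b(C)`. -/
def diffB : T C →ₗ[ℂ] T C := diff C + diffT C

/-! ### Characteristic maps and the Chern–Simons contraction -/

/-- The curvature `ω_φ(h) = d φ(h) + ∑ φ(h_0) φ(h_1)` of a linear map `φ` into an algebra `A`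
with differential `d`. -/
def curvature {C : Type*} [AddCommGroup C] [Module ℂ C] [Coalgebra ℂ C]
    {A : Type*} [Ring A] [Algebra ℂ A] (d : A →ₗ[ℂ] A) (φ : C →ₗ[ℂ] A) : C →ₗ[ℂ] A :=
  d ∘ₗ φ + conv φ φ

/-- The characteristic map `k(φ)`: the algebra map with `h ↦ φ(h)` and `ω_h ↦ ω_φ(h)`. -/
def charMap {C : Type*} [AddCommGroup C] [Module ℂ C] [Coalgebra ℂ C]
    {A : Type*} [Ring A] [Algebra ℂ A] (d : A →ₗ[ℂ] A) (φ : C →ₗ[ℂ] A) : T C →ₐ[ℂ] A :=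
  TensorAlgebra.lift ℂ (φ.coprod (curvature d φ))

/-- The algebra containing the graded tensor product of `T C` with the algebraic de Rham complex
`Ω(1) = ℂ[t] ⊕ ℂ[t] dt` of the line. The form `x + y dt`, with `x` and `y` polynomials in `t`
with coefficients in `T C`, is the matrix `(x, y; 0, x')`, where `x'` is `x` with the parity
automorphism applied to its coefficients; in this way
`(x + y dt) (z + w dt) = x z + (x w + y z') dt`, the product of the graded tensor product. -/
abbrev Forms : Type _ := Matrix (Fin 2) (Fin 2) (Polynomial (T C))

/-- A linear map applied to the coefficients of a polynomial in `t`. -/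
def coeffMap (f : T C →ₗ[ℂ] T C) : Polynomial (T C) →ₗ[ℂ] Polynomial (T C) :=
  Polynomial.lsum fun j => ((Polynomial.monomial j).restrictScalars ℂ) ∘ₗ f

/-- The form `x + y dt`, as an element of `Forms C`. -/
def form : (Polynomial (T C) × Polynomial (T C)) →ₗ[ℂ] Forms C where
  toFun p := !![p.1, p.2; 0, coeffMap C (parity C).toLinearMap p.1]
  map_add' p q := by
    ext i j : 2
    fin_cases i <;> fin_cases j <;> simp
  map_smul' c p := by
    ext i j : 2
    fin_cases i <;> fin_cases j <;> simp

/-- The coefficients `(x, y)` of a form `x + y dt`. -/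
def coeffs : Forms C →ₗ[ℂ] (Polynomial (T C) × Polynomial (T C)) :=
  (Matrix.entryLinearMap ℂ (Polynomial (T C)) 0 0).prod
    (Matrix.entryLinearMap ℂ (Polynomial (T C)) 0 1)

/-- The differential of the graded tensor product:
`x ⊗ t^j ↦ ∂x ⊗ t^j + (-1)^{|x|} x ⊗ j t^{j-1} dt` and `y ⊗ t^j dt ↦ ∂y ⊗ t^j dt`. -/
def formDiff : Forms C →ₗ[ℂ] Forms C :=
  form C ∘ₗ
    ((coeffMap C (diff C) ∘ₗ LinearMap.fst ℂ _ _).prod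
      ((Polynomial.derivative.restrictScalars ℂ ∘ₗ coeffMap C (parity C).toLinearMap) ∘ₗ
          LinearMap.fst ℂ _ _ +
        coeffMap C (diff C) ∘ₗ LinearMap.snd ℂ _ _)) ∘ₗ
    coeffs C

/-- The degree `-1` map `id ⊗ ∫_0^1` on the graded tensor product:
`x ⊗ t^j ↦ 0` and `y ⊗ t^j dt ↦ (-1)^{|y|} y / (j + 1)`. -/
def formInt : Forms C →ₗ[ℂ] T C :=
  (Polynomial.lsum fun j => ((j : ℂ) + 1)⁻¹ • (parity C).toLinearMap) ∘ₗ
    LinearMap.snd ℂ _ _ ∘ₗ coeffs C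

/-- The linear map `t · Id + (1 - t) · 0 : h ↦ h ⊗ t`. -/
def path : C →ₗ[ℂ] Forms C :=
  form C ∘ₗ LinearMap.inl ℂ _ _ ∘ₗ (Polynomial.monomial 1).restrictScalars ℂ ∘ₗ gen C

/-- The contraction `H = k(Id, 0)` of `W(C)`: the characteristic map of `h ↦ h ⊗ t` followed by
integration from `0` to `1`. -/
def contraction : T C →ₗ[ℂ] T C :=
  formInt C ∘ₗ (charMap (formDiff C) (path C)).toLinearMap

/-! ### The complexes `I_n(C)_♮`, `W_n(C)_♮` and their cyclic bicomplexes -/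

/-- The cohomology `H^k(I_n(C)_♮)` of `I_n(C)_♮ = I^{n+1} / [I, I^n]`. -/
abbrev HI (n : ℕ) (k : ℤ) : Type _ :=
  Coh (diff C) (gr C (curvPow C (n + 1))) (gr C (gradedComm C (curvPow C 1) (curvPow C n))) k

/-- The cohomology `H^k(W_n(C)_♮)` of `W_n(C)_♮ = W_n / [W_n, W_n] = W / (I^{n+1} + [W, W])`, where
`W_n = W / I^{n+1}`. -/
abbrev HW (n : ℕ) (k : ℤ) : Type _ :=
  Coh (diff C) (gr C (weil C)) (gr C (curvPow C (n + 1) ⊔ gradedComm C (weil C) (weil C))) k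

/-- Degree `m` of the total complex of a bicomplex with columns `p = 0, 1, 2, …`, each of them a
copy of the graded space `A`: families `x` with `x p ∈ A (m - p)`. -/
def tot (A : ℤ → Submodule ℂ (T C)) (m : ℤ) : Submodule ℂ (ℕ → T C) :=
  Submodule.pi Set.univ fun p => A (m - p)

/-- The vertical differential in column `p` of the cyclic bicomplex: `b` in the even columns (copies
of `W^b`), `-∂` in the odd columns (copies of `W`). -/
def vert (p : ℕ) : T C →ₗ[ℂ] T C := if Even p then diffB C else -diff C

/-- The horizontal differential from column `p` to column `p + 1` of the cyclic bicomplex: `t - 1`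
from the even columns to the odd ones, `N` from the odd columns to the even ones. -/
def horiz (p : ℕ) : T C →ₗ[ℂ] T C := if Even p then cyc C - 1 else cycNorm C

/-- The total differential of the first quadrant cyclic bicomplex
`W^b --(t-1)--> W --N--> W^b --(t-1)--> W --N--> ⋯`. -/
def totDiff : (ℕ → T C) →ₗ[ℂ] (ℕ → T C) :=
  LinearMap.pi fun p => vert C p ∘ₗ LinearMap.proj p +
    match p with
    | 0 => 0
    | q + 1 => horiz C q ∘ₗ LinearMap.proj q

/-- The augmentation `N`, with values in column `0` of the cyclic bicomplex. -/
def augment : T C →ₗ[ℂ] (ℕ → T C) := LinearMap.single ℂ (fun _ : ℕ => T C) 0 ∘ₗ cycNorm C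

/-- The shift of the cyclic bicomplex by two columns. -/
def shift : (ℕ → T C) →ₗ[ℂ] (ℕ → T C) :=
  LinearMap.pi fun p =>
    match p with
    | 0 => 0
    | 1 => 0
    | q + 2 => LinearMap.proj q

/-- `S` is the `S`-operator in degree `k` of the cohomology of the complex `A / B`, computed by the
total complex of the cyclic bicomplex of the quotient `A / J` through `N : A / B → (A / J)^b`:
the map `N` induces isomorphisms in cohomology, and `S` corresponds under them to the shift of the
bicomplex. -/
def IsSOperator (A B J : Submodule ℂ (T C)) (k : ℤ)
    (S : Coh (diff C) (gr C A) (gr C B) k →ₗ[ℂ] Coh (diff C) (gr C A) (gr C B) (k + 2)) : Prop :=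
  ∃ (ν : ∀ l : ℤ, Coh (diff C) (gr C A) (gr C B) l ≃ₗ[ℂ]
        Coh (totDiff C) (tot C (gr C A)) (tot C (gr C J)) l)
    (σ : Coh (totDiff C) (tot C (gr C A)) (tot C (gr C J)) k →ₗ[ℂ]
        Coh (totDiff C) (tot C (gr C A)) (tot C (gr C J)) (k + 2)),
    (∀ l, Induces (diff C) (gr C A) (gr C B) l
      (totDiff C) (tot C (gr C A)) (tot C (gr C J)) l (augment C) (ν l).toLinearMap) ∧
    Induces (totDiff C) (tot C (gr C A)) (tot C (gr C J)) k
      (totDiff C) (tot C (gr C A)) (tot C (gr C J)) (k + 2) (shift C) σ ∧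
    ∀ α, ν (k + 2) (S α) = σ (ν k α)

/-- The `S`-operator of `I_n(C)_♮`, from the cyclic bicomplex of `I_n(C) = I^{n+1}`. -/
def IsSOperatorI (n : ℕ) (k : ℤ) (S : HI C n k →ₗ[ℂ] HI C n (k + 2)) : Prop :=
  IsSOperator C (curvPow C (n + 1)) (gradedComm C (curvPow C 1) (curvPow C n)) ⊥ k S

/-- The `S`-operator of `W_n(C)_♮`, from the cyclic bicomplex of `W_n(C) = W / I^{n+1}`. -/
def IsSOperatorW (n : ℕ) (k : ℤ) (S : HW C n k →ₗ[ℂ] HW C n (k + 2)) : Prop :=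
  IsSOperator C (weil C) (curvPow C (n + 1) ⊔ gradedComm C (weil C) (weil C))
    (curvPow C (n + 1)) k S

/-- `φ` is the map `H^i(I_n(C)_♮) → H^j(W_n(C)_♮)`, `[x] ↦ [H x]`, induced by the Chern–Simons map
(`j = i - 1` in use). -/
def IsChernSimons (n : ℕ) (i j : ℤ) (φ : HI C n i →ₗ[ℂ] HW C n j) : Prop :=
  Induces (diff C) (gr C (curvPow C (n + 1)))
    (gr C (gradedComm C (curvPow C 1) (curvPow C n))) i
    (diff C) (gr C (weil C)) (gr C (curvPow C (n + 1) ⊔ gradedComm C (weil C) (weil C))) j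
    (contraction C) φ

end NCWeil

end

/-! The Weil algebra is contractible, and the contraction survives on commutator quotients. Write `k
= pathMap` and `H = contraction`. The map `k` is a morphism of DG algebras (`pathMap_diff`). At the
parameter value `1` it is the identity of `W`, and at `0` it vanishes on `W`. Stokes on the interval
(`formInt_formDiff`) therefore gives `H ∂ + ∂ H = id` on `W` (`contraction_diff_add`). Since `k` is
multiplicative, `H` carries commutators to commutators (`contraction_cyc_sub_mem`), so `W_♮ = W/[W,
W]` is contractible too.

The sequence `I_{n,♮} → W_♮ → W_{n,♮}` is short exact. The only point to check is `I^{n+1} ∩ [W, W]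
= [I, I^n]`. Everything is encoded by bidegrees, the numbers of letters `h` and `ω_h`: `I^m` is
spanned by the words with at least `m` letters `ω`, and `[W, W]` and `[I, I^n]` are the images of `t
- 1` on `W` and on `I^{n+1}` (`gradedComm_weil`, `gradedComm_curvPow`). Because `t` commutes with
the projections `part`, the intersection is as claimed. Hence the connecting map `H^{k-1}(W_{n,♮}) →
H^k(I_{n,♮})` is an isomorphism. It sends `y` to `a = ∂y - (t - 1)w`, with `w` chosen so that `a ∈
I^{n+1}`. Then `H a = y - ∂ H y - H (t - 1) w` represents the class of `y`, so the Chern–Simons map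
is its inverse.

For the bicomplex one needs `b² = 0`, `(t - 1) b = ∂ (t - 1)` and `b N = N ∂`, all consequences of
coassociativity. The rows are exact over `ℂ`, with a homotopy that preserves bidegrees and so
descends to `W/I^{n+1}`. Clearing columns from right to left, finitely many in each degree, shows
that `N` is a quasi-isomorphism from `R_♮` to the total complex (`exists_augment_equiv`).

Finally `[z] = S [x]` holds exactly when `N z` and the shift of `N x` are cohomologous. Let `z`
represent `S [H x]` in `W_n`: then `N z - shift (N (H x)) - D u` has entries in `I^{n+1}` for some
`u`. Its differential is `N a - shift (N x)`, where `a` is the connecting cocycle of `z`. So `a`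
represents `S [x]`, and the Chern–Simons map sends it to `[z]`. -/

noncomputable section

namespace NCWeil

section

/-! ### Words and bidegrees -/

section Bidegree

variable {C : Type*}

/-- The numbers of letters `h` and of letters `ω_h` in a word. -/
def bideg (l : List (C ⊕ C)) : ℕ × ℕ :=
  (l.map (Sum.elim (fun _ => ((1, 0) : ℕ × ℕ)) (fun _ => (0, 1)))).sum

@[simp] theorem bideg_nil : bideg ([] : List (C ⊕ C)) = 0 := rfl

@[simp] theorem bideg_inl_cons (h : C) (l : List (C ⊕ C)) :
    bideg (Sum.inl h :: l) = (1, 0) + bideg l := by simp [bideg]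

@[simp] theorem bideg_inr_cons (h : C) (l : List (C ⊕ C)) :
    bideg (Sum.inr h :: l) = (0, 1) + bideg l := by simp [bideg]

@[simp] theorem bideg_append (l l' : List (C ⊕ C)) : bideg (l ++ l') = bideg l + bideg l' := by
  simp [bideg]

theorem length_eq_bideg (l : List (C ⊕ C)) : l.length = (bideg l).1 + (bideg l).2 := by
  induction l with
  | nil => rfl
  | cons a l ih => rcases a with h | h <;> simp [ih] <;> ring

theorem wordDeg_eq_bideg (l : List (C ⊕ C)) : wordDeg C l = (bideg l).1 + 2 * (bideg l).2 := by
  induction l with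
  | nil => simp [wordDeg]
  | cons a l ih =>
    simp only [wordDeg, List.map_cons, List.sum_cons] at ih ⊢
    rcases a with h | h <;> simp [ih] <;> ring

theorem wordDeg_append (l l' : List (C ⊕ C)) :
    wordDeg C (l ++ l') = wordDeg C l + wordDeg C l' := by
  simp [wordDeg]

theorem ne_nil_iff_bideg (l : List (C ⊕ C)) : l ≠ [] ↔ 0 < (bideg l).1 + (bideg l).2 := by
  rw [← length_eq_bideg, List.length_pos_iff]

end Bidegree

variable {C : Type*} [AddCommGroup C] [Module ℂ C]

/-- The element of the free algebra given by a letter. -/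
abbrev letter (a : C ⊕ C) : T C := Sum.elim (gen C) (curv C) a

@[simp] theorem word_nil : word C [] = 1 := rfl

theorem word_cons (a : C ⊕ C) (l : List (C ⊕ C)) : word C (a :: l) = letter a * word C l := by
  simp [word]

theorem word_append (l l' : List (C ⊕ C)) : word C (l ++ l') = word C l * word C l' := by
  simp [word]

theorem word_singleton (a : C ⊕ C) : word C [a] = letter a := by simp [word]

section Lift

variable {A : Type*} [Ring A] [Algebra ℂ A]

@[simp] theorem lift_coprod_gen (f g : C →ₗ[ℂ] A) (h : C) :
    TensorAlgebra.lift ℂ (f.coprod g) (gen C h) = f h := by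
  simp [gen]

@[simp] theorem lift_coprod_curv (f g : C →ₗ[ℂ] A) (h : C) :
    TensorAlgebra.lift ℂ (f.coprod g) (curv C h) = g h := by
  simp [curv]

end Lift

/-- The span of the words whose bidegree lies in `S`. -/
def wordSpan (S : Set (ℕ × ℕ)) : Submodule ℂ (T C) :=
  Submodule.span ℂ {x | ∃ l, bideg l ∈ S ∧ word C l = x}

theorem word_mem_wordSpan {S : Set (ℕ × ℕ)} {l : List (C ⊕ C)} (h : bideg l ∈ S) :
    word C l ∈ wordSpan S := Submodule.subset_span ⟨l, h, rfl⟩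

theorem wordSpan_le {S : Set (ℕ × ℕ)} {P : Submodule ℂ (T C)} :
    wordSpan S ≤ P ↔ ∀ l, bideg l ∈ S → word C l ∈ P := by
  rw [wordSpan, Submodule.span_le]
  exact ⟨fun h l hl => h ⟨l, hl, rfl⟩, by rintro h _ ⟨l, hl, rfl⟩; exact h l hl⟩

theorem wordSpan_mono {S S' : Set (ℕ × ℕ)} (h : S ⊆ S') :
    (wordSpan S : Submodule ℂ (T C)) ≤ wordSpan S' :=
  wordSpan_le.2 fun _ hl => word_mem_wordSpan (h hl)

theorem wordSpan_empty : (wordSpan ∅ : Submodule ℂ (T C)) = ⊥ :=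
  le_bot_iff.1 (wordSpan_le.2 fun _ hl => hl.elim)

theorem mul_mem_wordSpan {S S' R : Set (ℕ × ℕ)} (h : ∀ p ∈ S, ∀ q ∈ S', p + q ∈ R) {x y : T C}
    (hx : x ∈ wordSpan S) (hy : y ∈ wordSpan S') : x * y ∈ wordSpan R := by
  suffices (wordSpan S : Submodule ℂ (T C)) * wordSpan S' ≤ wordSpan R from
    this (Submodule.mul_mem_mul hx hy)
  rw [wordSpan, wordSpan, Submodule.span_mul_span, Submodule.span_le]
  rintro _ ⟨_, ⟨l, hl, rfl⟩, _, ⟨l', hl', rfl⟩, rfl⟩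
  simp only [← word_append]
  exact word_mem_wordSpan (by simpa using h _ hl _ hl')

theorem wordSpan_univ : (wordSpan Set.univ : Submodule ℂ (T C)) = ⊤ := by
  rw [eq_top_iff]
  rintro x -
  induction x using TensorAlgebra.induction with
  | algebraMap r =>
    rw [Algebra.algebraMap_eq_smul_one]
    exact Submodule.smul_mem _ _ (word_mem_wordSpan (l := []) trivial)
  | ι v =>
    have : TensorAlgebra.ι ℂ v = word C [Sum.inl v.1] + word C [Sum.inr v.2] := by
      simp [word, gen, curv, ← map_add]
    rw [this]
    exact add_mem (word_mem_wordSpan trivial) (word_mem_wordSpan trivial)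
  | mul a b ha hb => exact mul_mem_wordSpan (fun _ _ _ _ => Set.mem_univ _) ha hb
  | add a b ha hb => exact add_mem ha hb

section Ext

variable {M : Type*} [AddCommGroup M] [Module ℂ M]

theorem eqOn_wordSpan {S : Set (ℕ × ℕ)} {f g : T C →ₗ[ℂ] M}
    (h : ∀ l, bideg l ∈ S → f (word C l) = g (word C l)) {x : T C} (hx : x ∈ wordSpan S) :
    f x = g x := by
  suffices wordSpan S ≤ LinearMap.eqLocus f g from this hx
  exact wordSpan_le.2 h

theorem ext_word {f g : T C →ₗ[ℂ] M} (h : ∀ l, f (word C l) = g (word C l)) : f = g :=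
  LinearMap.ext fun x => eqOn_wordSpan (S := Set.univ) (fun l _ => h l)
    (by rw [wordSpan_univ]; trivial)

/-- Linear maps on the free algebra are compared by induction on the first letter. -/
theorem ext_left {f g : T C →ₗ[ℂ] M} (h1 : f 1 = g 1)
    (hgen : ∀ h x, f x = g x → f (gen C h * x) = g (gen C h * x))
    (hcurv : ∀ h x, f x = g x → f (curv C h * x) = g (curv C h * x)) : f = g := by
  refine ext_word fun l => ?_
  induction l with
  | nil => exact h1
  | cons a l ih =>
    rw [word_cons]
    rcases a with h | h
    · exact hgen h _ ih
    · exact hcurv h _ ih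

end Ext

/-! ### Projections onto sets of bidegrees -/

/-- The free algebra homomorphism recording bidegrees. -/
def bigrading : T C →ₐ[ℂ] AddMonoidAlgebra (T C) (ℕ × ℕ) :=
  TensorAlgebra.lift ℂ
    ((AddMonoidAlgebra.lsingle (1, 0) ∘ₗ gen C).coprod
      (AddMonoidAlgebra.lsingle (0, 1) ∘ₗ curv C))

theorem bigrading_word (l : List (C ⊕ C)) :
    bigrading (word C l) = AddMonoidAlgebra.single (bideg l) (word C l) := by
  induction l with
  | nil => simp [AddMonoidAlgebra.one_def]
  | cons a l ih =>
    rw [word_cons, map_mul, ih]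
    rcases a with h | h <;>
      simp [bigrading, AddMonoidAlgebra.single_mul_single]

open Classical in
/-- The projection onto the span of the words with bidegree in `S`. -/
def part (S : Set (ℕ × ℕ)) : T C →ₗ[ℂ] T C :=
  Finsupp.lsum ℂ (fun p => if p ∈ S then LinearMap.id else 0) ∘ₗ
    (AddMonoidAlgebra.coeffLinearEquiv ℂ).toLinearMap ∘ₗ bigrading.toLinearMap

open Classical in
theorem part_word (S : Set (ℕ × ℕ)) (l : List (C ⊕ C)) :
    part S (word C l) = if bideg l ∈ S then word C l else 0 := by
  simp only [part, LinearMap.comp_apply, AlgHom.toLinearMap_apply, bigrading_word]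
  by_cases h : bideg l ∈ S <;> simp [h]

theorem part_mem (S : Set (ℕ × ℕ)) {R : Set (ℕ × ℕ)} {x : T C} (hx : x ∈ wordSpan R) :
    part S x ∈ wordSpan (R ∩ S) := by
  suffices wordSpan R ≤ (wordSpan (R ∩ S)).comap (part S) from this hx
  refine wordSpan_le.2 fun l hl => ?_
  rw [Submodule.mem_comap, part_word]
  split_ifs with h
  · exact word_mem_wordSpan ⟨hl, h⟩
  · exact zero_mem _

theorem part_eq_self {S : Set (ℕ × ℕ)} {x : T C} (hx : x ∈ wordSpan S) : part S x = x :=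
  eqOn_wordSpan (g := LinearMap.id) (fun l hl => by simp [part_word, hl]) hx

/-- `part R` is the identity on the second span and maps the first into the span of the
intersection. Words are not linearly independent, being linear in each letter, so the bigrading has
to come from an algebra map. -/
theorem wordSpan_inf (S R : Set (ℕ × ℕ)) :
    (wordSpan S ⊓ wordSpan R : Submodule ℂ (T C)) = wordSpan (S ∩ R) := by
  refine le_antisymm ?_
    (le_inf (wordSpan_mono Set.inter_subset_left) (wordSpan_mono Set.inter_subset_right))
  rintro x ⟨hS, hR⟩
  rw [← part_eq_self hR]
  exact part_mem R hS

end

section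

variable {C : Type*} [AddCommGroup C] [Module ℂ C]

/-! ### Parity and the cyclic permutation -/

@[simp] theorem parity_gen (h : C) : parity C (gen C h) = -gen C h := by simp [parity]

@[simp] theorem parity_curv (h : C) : parity C (curv C h) = curv C h := by simp [parity]

/-- The sign `(-1)^i`. -/
def sgn (i : ℤ) : ℤ := (((-1 : ℤˣ) ^ i : ℤˣ) : ℤ)

@[simp] theorem sgn_zero : sgn 0 = 1 := by simp [sgn]

@[simp] theorem sgn_one : sgn 1 = -1 := by simp [sgn]

@[simp] theorem sgn_two : sgn 2 = 1 := by simp [sgn]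

theorem sgn_add (i j : ℤ) : sgn (i + j) = sgn i * sgn j := by simp [sgn, zpow_add]

@[simp] theorem sgn_mul_self (i : ℤ) : sgn i * sgn i = 1 := by
  rw [sgn, ← Units.val_mul, ← sq]
  simp

@[simp] theorem sgn_two_mul (i : ℤ) : sgn (2 * i) = 1 := by rw [two_mul, sgn_add, sgn_mul_self]

theorem parity_word (l : List (C ⊕ C)) :
    parity C (word C l) = sgn (wordDeg C l) • word C l := by
  induction l with
  | nil => simp [wordDeg]
  | cons a l ih =>
    have : wordDeg C (a :: l) = wordDeg C [a] + wordDeg C l := wordDeg_append [a] l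
    rw [word_cons, map_mul, ih, this, sgn_add]
    rcases a with h | h <;> simp [wordDeg, -zsmul_eq_mul]

@[simp] theorem parity_parity (x : T C) : parity C (parity C x) = x := by
  have : (parity C).toLinearMap ∘ₗ (parity C).toLinearMap = LinearMap.id := by
    apply ext_left
    · simp
    · intro h x hx
      simp only [LinearMap.comp_apply, AlgHom.toLinearMap_apply, LinearMap.id_apply] at hx ⊢
      simp [hx]
    · intro h x hx
      simp only [LinearMap.comp_apply, AlgHom.toLinearMap_apply, LinearMap.id_apply] at hx ⊢
      simp [hx]
  exact LinearMap.congr_fun this x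

@[simp] theorem cyc_one : cyc C 1 = 0 := leftRec_one _

theorem cyc_word_cons (a : C ⊕ C) (l : List (C ⊕ C)) : cyc C (word C (a :: l)) =
    sgn (wordDeg C [a] * wordDeg C l) • word C (l ++ [a]) := by
  rw [word_cons, word_append, word_singleton]
  rcases a with h | h
  · simp [cyc_gen_mul, parity_word, wordDeg, -zsmul_eq_mul]
  · simp [cyc_curv_mul, wordDeg]

/-- Moving a prefix of a word to the end. -/
theorem cyc_pow_word_append (u v : List (C ⊕ C)) : (cyc C ^ u.length) (word C (u ++ v)) =
    sgn (wordDeg C u * wordDeg C v) • word C (v ++ u) := by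
  induction u generalizing v with
  | nil => simp [wordDeg]
  | cons a u ih =>
    have e : wordDeg C (a :: u) = wordDeg C [a] + wordDeg C u := wordDeg_append [a] u
    rw [List.length_cons, pow_succ, Module.End.mul_apply, List.cons_append, cyc_word_cons,
      map_zsmul, List.append_assoc, ih, smul_smul, List.append_assoc, List.singleton_append]
    congr 1
    -- The exponents differ by twice the product of the degrees of `a` and `u`, which does not
    -- affect the sign.
    rw [wordDeg_append, wordDeg_append, e, ← sgn_add,
      show wordDeg C [a] * (wordDeg C u + wordDeg C v) +
        wordDeg C u * (wordDeg C v + wordDeg C [a]) =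
        (wordDeg C [a] + wordDeg C u) * wordDeg C v + 2 * (wordDeg C [a] * wordDeg C u) by ring,
      sgn_add, sgn_two_mul, mul_one]

theorem cyc_pow_length_word (l : List (C ⊕ C)) : (cyc C ^ l.length) (word C l) = word C l := by
  simpa [wordDeg] using cyc_pow_word_append l []

theorem cyc_parity (x : T C) : cyc C (parity C x) = parity C (cyc C x) := by
  suffices cyc C ∘ₗ (parity C).toLinearMap = (parity C).toLinearMap ∘ₗ cyc C from
    LinearMap.congr_fun this x
  apply ext_left <;> simp [cyc_gen_mul, cyc_curv_mul]

/-! ### Convolutions -/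

section Convolution

variable [Coalgebra ℂ C] {A B : Type*} [Ring A] [Algebra ℂ A] [Ring B] [Algebra ℂ B]

theorem conv_eq_sum (f g : C →ₗ[ℂ] A) (c : C) : conv f g c =
    ∑ i ∈ (Coalgebra.Repr.arbitrary ℂ c).index, f ((Coalgebra.Repr.arbitrary ℂ c).left i) *
      g ((Coalgebra.Repr.arbitrary ℂ c).right i) := by
  simp only [conv, LinearMap.comp_apply]
  conv_lhs => rw [← (Coalgebra.Repr.arbitrary ℂ c).eq]
  simp

theorem conv_assoc (f g h : C →ₗ[ℂ] A) : conv (conv f g) h = conv f (conv g h) := by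
  ext c
  have := congrArg (LinearMap.mul' ℂ A ∘ₗ TensorProduct.map f
    (LinearMap.mul' ℂ A ∘ₗ TensorProduct.map g h)) (Coalgebra.coassoc_apply (R := ℂ) c)
  have e : LinearMap.mul' ℂ A ∘ₗ TensorProduct.map f
      (LinearMap.mul' ℂ A ∘ₗ TensorProduct.map g h) ∘ₗ
        (TensorProduct.assoc ℂ C C C).toLinearMap =
      LinearMap.mul' ℂ A ∘ₗ TensorProduct.map (LinearMap.mul' ℂ A ∘ₗ TensorProduct.map f g) h := by
    ext; simp [mul_assoc]
  have e1 : conv f (conv g h) c = (LinearMap.mul' ℂ A ∘ₗ TensorProduct.map f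
      (LinearMap.mul' ℂ A ∘ₗ TensorProduct.map g h))
        (Coalgebra.comul.lTensor C (Coalgebra.comul (R := ℂ) c)) := by
    simp only [conv, LinearMap.comp_apply, LinearMap.lTensor]
    rw [← LinearMap.comp_apply (TensorProduct.map _ _) (TensorProduct.map _ _),
      ← TensorProduct.map_comp]
    simp [LinearMap.comp_assoc]
  have e2 : conv (conv f g) h c = (LinearMap.mul' ℂ A ∘ₗ
      TensorProduct.map (LinearMap.mul' ℂ A ∘ₗ TensorProduct.map f g) h)
        (Coalgebra.comul.rTensor C (Coalgebra.comul (R := ℂ) c)) := by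
    simp only [conv, LinearMap.comp_apply, LinearMap.rTensor]
    rw [← LinearMap.comp_apply (TensorProduct.map _ _) (TensorProduct.map _ _),
      ← TensorProduct.map_comp]
    simp [LinearMap.comp_assoc]
  rw [e1, e2, ← this, ← e]
  rfl

theorem conv_add_left (f f' g : C →ₗ[ℂ] A) : conv (f + f') g = conv f g + conv f' g := by
  ext; simp [conv, TensorProduct.map_add_left]

theorem conv_add_right (f g g' : C →ₗ[ℂ] A) : conv f (g + g') = conv f g + conv f g' := by
  ext; simp [conv, TensorProduct.map_add_right]

theorem conv_neg_left (f g : C →ₗ[ℂ] A) : conv (-f) g = -conv f g := by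
  rw [eq_neg_iff_add_eq_zero, ← conv_add_left]
  ext; simp [conv]

theorem conv_neg_right (f g : C →ₗ[ℂ] A) : conv f (-g) = -conv f g := by
  rw [eq_neg_iff_add_eq_zero, ← conv_add_right]
  ext; simp [conv]

theorem map_conv (F : A →ₐ[ℂ] B) (f g : C →ₗ[ℂ] A) :
    F.toLinearMap ∘ₗ conv f g = conv (F.toLinearMap ∘ₗ f) (F.toLinearMap ∘ₗ g) := by
  ext c; simp [conv_eq_sum]

end Convolution

end

section

variable {C : Type*} [AddCommGroup C] [Module ℂ C]

/-! ### Derivations of the free algebra -/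

/-- The (graded) derivation of odd degree with values `δ v` on the letters `v`. -/
def der (δ : C × C →ₗ[ℂ] T C) : T C →ₗ[ℂ] T C :=
  leftRec (LinearMap.mk₂ ℂ
    (fun v (p : T C × T C) => δ v * p.1 + parity C (TensorAlgebra.ι ℂ v) * p.2)
    (by intros; simp [add_mul]; abel)
    (by intros; simp)
    (by intros; simp [mul_add]; abel)
    (by intros; simp))

section Derivation

variable (δ : C × C →ₗ[ℂ] T C)

@[simp] theorem der_one : der δ 1 = 0 := leftRec_one _

theorem der_ι_mul (v : C × C) (x : T C) : der δ (TensorAlgebra.ι ℂ v * x) =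
    δ v * x + parity C (TensorAlgebra.ι ℂ v) * der δ x := by
  simp [der, leftRec_ι_mul]

theorem der_gen_mul (h : C) (x : T C) :
    der δ (gen C h * x) = δ (h, 0) * x - gen C h * der δ x := by
  have := der_ι_mul δ (h, 0) x
  rw [show TensorAlgebra.ι ℂ (h, (0 : C)) = gen C h from rfl] at this
  rw [this, parity_gen, neg_mul, sub_eq_add_neg]

theorem der_curv_mul (h : C) (x : T C) :
    der δ (curv C h * x) = δ (0, h) * x + curv C h * der δ x := by
  have := der_ι_mul δ (0, h) x
  rw [show TensorAlgebra.ι ℂ ((0 : C), h) = curv C h from rfl] at this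
  rw [this, parity_curv]

@[simp] theorem der_gen (h : C) : der δ (gen C h) = δ (h, 0) := by
  simpa using der_gen_mul δ h 1

@[simp] theorem der_curv (h : C) : der δ (curv C h) = δ (0, h) := by
  simpa using der_curv_mul δ h 1

theorem der_mul (x y : T C) : der δ (x * y) = der δ x * y + parity C x * der δ y := by
  suffices der δ ∘ₗ LinearMap.mulRight ℂ y =
      LinearMap.mulRight ℂ y ∘ₗ der δ +
        LinearMap.mulRight ℂ (der δ y) ∘ₗ (parity C).toLinearMap by
    simpa using LinearMap.congr_fun this x
  apply ext_left
  · simp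
  · intro h x hx
    simp only [LinearMap.comp_apply, LinearMap.add_apply, LinearMap.mulRight_apply,
      AlgHom.toLinearMap_apply] at hx ⊢
    rw [mul_assoc, der_gen_mul, hx, der_gen_mul, map_mul, parity_gen]
    noncomm_ring
  · intro h x hx
    simp only [LinearMap.comp_apply, LinearMap.add_apply, LinearMap.mulRight_apply,
      AlgHom.toLinearMap_apply] at hx ⊢
    rw [mul_assoc, der_curv_mul, hx, der_curv_mul, map_mul, parity_curv]
    noncomm_ring

theorem der_add (δ' : C × C →ₗ[ℂ] T C) (x : T C) : der (δ + δ') x = der δ x + der δ' x := by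
  suffices der (δ + δ') = der δ + der δ' by rw [this]; rfl
  apply ext_left
  · simp
  · intro h x hx
    rw [LinearMap.add_apply] at hx ⊢
    rw [der_gen_mul, der_gen_mul, der_gen_mul, hx, LinearMap.add_apply]
    noncomm_ring
  · intro h x hx
    rw [LinearMap.add_apply] at hx ⊢
    rw [der_curv_mul, der_curv_mul, der_curv_mul, hx, LinearMap.add_apply]
    noncomm_ring

variable {δ}

theorem der_parity (h1 : ∀ h, parity C (δ (h, 0)) = δ (h, 0))
    (h2 : ∀ h, parity C (δ (0, h)) = -δ (0, h)) (x : T C) :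
    der δ (parity C x) = -parity C (der δ x) := by
  suffices der δ ∘ₗ (parity C).toLinearMap = -((parity C).toLinearMap ∘ₗ der δ) from
    LinearMap.congr_fun this x
  apply ext_left
  · simp
  · intro h x hx
    simp only [LinearMap.comp_apply, LinearMap.neg_apply, AlgHom.toLinearMap_apply] at hx ⊢
    rw [map_mul, parity_gen, neg_mul, map_neg, der_gen_mul, hx, der_gen_mul, map_sub, map_mul,
      map_mul, parity_gen, h1]
    noncomm_ring
  · intro h x hx
    simp only [LinearMap.comp_apply, LinearMap.neg_apply, AlgHom.toLinearMap_apply] at hx ⊢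
    rw [map_mul, parity_curv, der_curv_mul, hx, der_curv_mul, map_add, map_mul, map_mul,
      parity_curv, h2]
    noncomm_ring

/-- For an odd derivation the cross terms of the square cancel, so the square vanishes once it does
so on letters. The first two hypotheses say that `δ` reverses parity. -/
theorem der_der (h1 : ∀ h, parity C (δ (h, 0)) = δ (h, 0))
    (h2 : ∀ h, parity C (δ (0, h)) = -δ (0, h))
    (h3 : ∀ h, der δ (δ (h, 0)) = 0) (h4 : ∀ h, der δ (δ (0, h)) = 0) (x : T C) :
    der δ (der δ x) = 0 := by
  suffices der δ ∘ₗ der δ = 0 from LinearMap.congr_fun this x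
  apply ext_left
  · simp
  · intro h x hx
    simp only [LinearMap.comp_apply, LinearMap.zero_apply] at hx ⊢
    rw [der_gen_mul, map_sub, der_mul, der_gen_mul, hx, h1, h3]
    noncomm_ring
  · intro h x hx
    simp only [LinearMap.comp_apply, LinearMap.zero_apply] at hx ⊢
    rw [der_curv_mul, map_add, der_mul, der_curv_mul, hx, h2, h4]
    noncomm_ring

end Derivation

theorem parity_comp_gen : (parity C).toLinearMap ∘ₗ gen C = -gen C := by ext; simp

theorem parity_comp_curv : (parity C).toLinearMap ∘ₗ curv C = curv C := by ext; simp

variable [Coalgebra ℂ C]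

theorem der_conv (δ : C × C →ₗ[ℂ] T C) (f g : C →ₗ[ℂ] T C) :
    der δ ∘ₗ conv f g =
      conv (der δ ∘ₗ f) g + conv ((parity C).toLinearMap ∘ₗ f) (der δ ∘ₗ g) := by
  ext c
  simp [conv_eq_sum, der_mul, Finset.sum_add_distrib]

theorem parity_conv (f g : C →ₗ[ℂ] T C) : (parity C).toLinearMap ∘ₗ conv f g =
    conv ((parity C).toLinearMap ∘ₗ f) ((parity C).toLinearMap ∘ₗ g) := map_conv _ _ _

theorem diff0Gen_gen (h : C) : diff0Gen C (h, 0) = -conv (gen C) (gen C) h := by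
  simp [diff0Gen]

theorem diff0Gen_curv (h : C) :
    diff0Gen C (0, h) = conv (curv C) (gen C) h - conv (gen C) (curv C) h := by
  simp [diff0Gen]

theorem diffGen_gen (h : C) : diffGen C (h, 0) = curv C h - conv (gen C) (gen C) h := by
  simp [diffGen, diff0Gen_gen]; abel

theorem diffGen_curv (h : C) :
    diffGen C (0, h) = conv (curv C) (gen C) h - conv (gen C) (curv C) h := by
  simp [diffGen, diff0Gen_curv]

theorem parity_conv_gen_gen (h : C) :
    parity C (conv (gen C) (gen C) h) = conv (gen C) (gen C) h := by
  simpa [parity_comp_gen, conv_neg_left, conv_neg_right] using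
    LinearMap.congr_fun (parity_conv (gen C) (gen C)) h

theorem parity_conv_curv_gen (h : C) :
    parity C (conv (curv C) (gen C) h) = -conv (curv C) (gen C) h := by
  simpa [parity_comp_gen, parity_comp_curv, conv_neg_left, conv_neg_right] using
    LinearMap.congr_fun (parity_conv (curv C) (gen C)) h

theorem parity_conv_gen_curv (h : C) :
    parity C (conv (gen C) (curv C) h) = -conv (gen C) (curv C) h := by
  simpa [parity_comp_gen, parity_comp_curv, conv_neg_left, conv_neg_right] using
    LinearMap.congr_fun (parity_conv (gen C) (curv C)) h

variable (C) in
/-- The derivation `∂_0`. -/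
abbrev diff0 : T C →ₗ[ℂ] T C := der (diff0Gen C)

variable (C) in
/-- The derivation `∂ - ∂_0`, with `h ↦ ω_h` and `ω_h ↦ 0`. -/
abbrev diffCurv : T C →ₗ[ℂ] T C := der (curv C ∘ₗ LinearMap.fst ℂ C C)

/-- `der` uses the same recursion as `diff`, so facts on general derivations apply to `∂`. -/
theorem diff_eq_der : diff C = der (diffGen C) := rfl

theorem diff_eq_add (x : T C) : diff C x = diff0 C x + diffCurv C x := der_add _ _ _

theorem parity_diff0Gen_gen (h : C) : parity C (diff0Gen C (h, 0)) = diff0Gen C (h, 0) := by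
  rw [diff0Gen_gen, map_neg, parity_conv_gen_gen]

theorem parity_diff0Gen_curv (h : C) : parity C (diff0Gen C (0, h)) = -diff0Gen C (0, h) := by
  rw [diff0Gen_curv, map_sub, parity_conv_gen_curv, parity_conv_curv_gen]
  abel

theorem parity_diffGen_gen (h : C) : parity C (diffGen C (h, 0)) = diffGen C (h, 0) := by
  rw [diffGen_gen, map_sub, parity_conv_gen_gen, parity_curv]

theorem parity_diffGen_curv (h : C) : parity C (diffGen C (0, h)) = -diffGen C (0, h) := by
  rw [diffGen_curv, map_sub, parity_conv_gen_curv, parity_conv_curv_gen]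
  abel

theorem diff_parity (x : T C) : diff C (parity C x) = -parity C (diff C x) :=
  der_parity parity_diffGen_gen parity_diffGen_curv x

theorem diff_mul (x y : T C) : diff C (x * y) = diff C x * y + parity C x * diff C y :=
  der_mul _ x y

@[simp] theorem diff_one : diff C 1 = 0 := der_one _

theorem diff_gen (h : C) : diff C (gen C h) = curv C h - conv (gen C) (gen C) h := by
  rw [diff_eq_der, der_gen, diffGen_gen]

theorem diff_curv (h : C) :
    diff C (curv C h) = conv (curv C) (gen C) h - conv (gen C) (curv C) h := by
  rw [diff_eq_der, der_curv, diffGen_curv]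

theorem diff_comp_gen : diff C ∘ₗ gen C = curv C - conv (gen C) (gen C) := by
  ext h; simp [diff_gen]

theorem diff_comp_curv : diff C ∘ₗ curv C = conv (curv C) (gen C) - conv (gen C) (curv C) := by
  ext h; simp [diff_curv]

theorem diff0_comp_gen : diff0 C ∘ₗ gen C = -conv (gen C) (gen C) := by
  ext h; simp [diff0Gen_gen]

theorem diff0_comp_curv : diff0 C ∘ₗ curv C = conv (curv C) (gen C) - conv (gen C) (curv C) := by
  ext h; simp [diff0Gen_curv]

theorem diff0_diff0Gen_gen (h : C) : diff0 C (diff0Gen C (h, 0)) = 0 := by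
  rw [diff0Gen_gen, map_neg, neg_eq_zero, ← LinearMap.comp_apply, der_conv, diff0_comp_gen,
    parity_comp_gen]
  simp only [conv_neg_left, conv_neg_right, conv_assoc]
  simp

theorem diff0_diff0Gen_curv (h : C) : diff0 C (diff0Gen C (0, h)) = 0 := by
  rw [diff0Gen_curv, map_sub, ← LinearMap.comp_apply, ← LinearMap.comp_apply, der_conv, der_conv,
    diff0_comp_gen, diff0_comp_curv, parity_comp_gen, parity_comp_curv]
  simp only [conv_neg_left, conv_neg_right, conv_assoc, sub_eq_add_neg, conv_add_left,
    conv_add_right]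
  simp

/-- On `h`, the terms of `∂ ω_h` cancel those that come from the curvature in `∂ (h_0 h_1)`. The
remaining threefold convolutions cancel in pairs by coassociativity, on `h` as on `ω_h`. -/
theorem diff_diff (x : T C) : diff C (diff C x) = 0 := by
  refine der_der parity_diffGen_gen parity_diffGen_curv (fun h => ?_) (fun h => ?_) x
  · rw [← diff_eq_der, diffGen_gen, map_sub, ← LinearMap.comp_apply, ← LinearMap.comp_apply,
      diff_eq_der, der_conv, ← diff_eq_der, diff_comp_gen, diff_comp_curv, parity_comp_gen]
    simp only [conv_neg_left, conv_neg_right, conv_assoc, sub_eq_add_neg, conv_add_left,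
      conv_add_right]
    simp
    abel
  · rw [← diff_eq_der, diffGen_curv, map_sub, ← LinearMap.comp_apply, ← LinearMap.comp_apply,
      diff_eq_der, der_conv, der_conv, ← diff_eq_der, diff_comp_gen, diff_comp_curv,
      parity_comp_gen, parity_comp_curv]
    simp only [conv_neg_left, conv_neg_right, conv_assoc, sub_eq_add_neg, conv_add_left,
      conv_add_right]
    simp
    abel

/-! ### The extra face and the differential `b` -/

variable (C) in
/-- The operator `∂_0` applied to the first letter, `a x ↦ ∂_0(a) x`. -/
def diffHead : T C →ₗ[ℂ] T C :=
  leftRec (LinearMap.mk₂ ℂ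
    (fun v (p : T C × T C) => diff0Gen C v * p.1)
    (by intros; simp [add_mul])
    (by intros; simp)
    (by intros; simp [mul_add])
    (by intros; simp))

@[simp] theorem diffHead_one : diffHead C 1 = 0 := leftRec_one _

theorem diffHead_gen_mul (h : C) (x : T C) :
    diffHead C (gen C h * x) = diff0Gen C (h, 0) * x := by
  simp [diffHead, gen, leftRec_ι_mul]

theorem diffHead_curv_mul (h : C) (x : T C) :
    diffHead C (curv C h * x) = diff0Gen C (0, h) * x := by
  simp [diffHead, curv, leftRec_ι_mul]

theorem diffT_eq : diffT C = cyc C ∘ₗ diffHead C := by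
  apply ext_left
  · simp [diffT, leftRec_one]
  · intro h x _
    rw [LinearMap.comp_apply, diffHead_gen_mul]
    exact diffT_ι_mul C _ _
  · intro h x _
    rw [LinearMap.comp_apply, diffHead_curv_mul]
    exact diffT_ι_mul C _ _

theorem diffB_apply (x : T C) : diffB C x = diff C x + cyc C (diffHead C x) := by
  rw [diffB, diffT_eq]; rfl

/-- `∂ t = t ∂ + (t - 1) t d`, where `d` is `∂_0` on the first letter. -/
theorem diff_cyc (x : T C) : diff C (cyc C x) =
    cyc C (diff C x) + cyc C (cyc C (diffHead C x)) - cyc C (diffHead C x) := by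
  suffices diff C ∘ₗ cyc C = cyc C ∘ₗ diff C + cyc C ∘ₗ cyc C ∘ₗ diffHead C - cyc C ∘ₗ diffHead C
    from LinearMap.congr_fun this x
  apply ext_left
  · simp
  · intro h x _
    simp only [LinearMap.comp_apply, LinearMap.add_apply, LinearMap.sub_apply]
    rw [cyc_gen_mul, diff_mul, diff_parity, parity_parity, diff_eq_der, der_gen_mul,
      diffHead_gen_mul, ← diff_eq_der, map_sub, cyc_gen_mul, diff_gen, diffGen_gen, diff0Gen_gen]
    -- Two turns are needed to move both letters of `∂_0 h` to the end, whereas `t ∂` moves only the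
    -- first. This is the source of the correction `(t - 1) t d`.
    have : cyc C (cyc C (conv (gen C) (gen C) h * x)) = x * conv (gen C) (gen C) h := by
      simp [conv_eq_sum, Finset.sum_mul, Finset.mul_sum, mul_assoc, cyc_gen_mul]
    simp only [sub_mul, map_sub, neg_mul, map_neg, this, cyc_curv_mul]
    noncomm_ring
  · intro h x _
    simp only [LinearMap.comp_apply, LinearMap.add_apply, LinearMap.sub_apply]
    rw [cyc_curv_mul, diff_mul, diff_eq_der, der_curv_mul,
      diffHead_curv_mul, ← diff_eq_der, map_add, cyc_curv_mul, diff_curv, diffGen_curv,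
      diff0Gen_curv]
    have h1 : cyc C (cyc C (conv (gen C) (curv C) h * x)) =
        parity C x * conv (gen C) (curv C) h := by
      simp [conv_eq_sum, Finset.sum_mul, Finset.mul_sum, mul_assoc, cyc_gen_mul, cyc_curv_mul]
    have h2 : cyc C (cyc C (conv (curv C) (gen C) h * x)) =
        parity C x * conv (curv C) (gen C) h := by
      simp [conv_eq_sum, Finset.sum_mul, Finset.mul_sum, mul_assoc, cyc_gen_mul, cyc_curv_mul]
    simp only [sub_mul, map_sub, h1, h2]
    noncomm_ring

/-- `(t - 1) b = ∂ (t - 1)`. -/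
theorem cyc_sub_diffB (x : T C) : cyc C (diffB C x) - diffB C x = diff C (cyc C x - x) := by
  rw [map_sub, diff_cyc, diffB_apply, map_add]
  abel

theorem diff_diff0Gen_gen (h : C) : diff C (diff0Gen C (h, 0)) = -diff0Gen C (0, h) := by
  have := diff_diff (gen C h)
  rw [diff_gen, sub_eq_add_neg, ← diff0Gen_gen, map_add, diff_curv, ← diff0Gen_curv] at this
  rw [eq_neg_iff_add_eq_zero, add_comm, this]

theorem diff_diff0Gen_curv (h : C) : diff C (diff0Gen C (0, h)) = 0 := by
  have := diff_diff (curv C h)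
  rwa [diff_curv, ← diff0Gen_curv] at this

theorem diff_gen_mul (h : C) (x : T C) : diff C (gen C h * x) =
    curv C h * x + diff0Gen C (h, 0) * x - gen C h * diff C x := by
  rw [diff_mul, diff_gen, diff0Gen_gen, parity_gen]
  noncomm_ring

theorem diff_curv_mul (h : C) (x : T C) : diff C (curv C h * x) =
    diff0Gen C (0, h) * x + curv C h * diff C x := by
  rw [diff_mul, diff_curv, diff0Gen_curv, parity_curv]

/-- The terms that contain `∂ x` cancel. Since `∂ ∂_0 h = -∂_0 ω_h`, the curvature letter in `∂ h`
contributes nothing, and what is left is `d` on the first letter of `∂_0(a) x`. -/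
theorem diff_diffHead (x : T C) :
    diff C (diffHead C x) + diffHead C (diff C x) = diffHead C (diffHead C x) := by
  suffices diff C ∘ₗ diffHead C + diffHead C ∘ₗ diff C = diffHead C ∘ₗ diffHead C from
    LinearMap.congr_fun this x
  apply ext_left
  · simp
  · intro h x _
    simp only [LinearMap.comp_apply, LinearMap.add_apply]
    rw [diff_gen_mul, diffHead_gen_mul, diff_mul, diff_diff0Gen_gen, parity_diff0Gen_gen, map_sub,
      map_add, diffHead_gen_mul, diffHead_curv_mul]
    noncomm_ring
  · intro h x _
    simp only [LinearMap.comp_apply, LinearMap.add_apply]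
    rw [diff_curv_mul, diffHead_curv_mul, diff_mul, diff_diff0Gen_curv, parity_diff0Gen_curv,
      map_add, diffHead_curv_mul]
    noncomm_ring

/-- `t d` differentiates the first of the two leading letters and `d t` the second; together they
give `∂_0` of the product. -/
theorem cyc_diffHead_conv (f g : C →ₗ[ℂ] T C) (hf : f = gen C ∨ f = curv C)
    (hg : g = gen C ∨ g = curv C) (h : C) (x : T C) :
    cyc C (diffHead C (conv f g h * x)) + diffHead C (cyc C (conv f g h * x)) =
      cyc C (diff0 C (conv f g h) * x) := by
  have key : ∀ a b, cyc C (diffHead C (f a * g b * x)) + diffHead C (cyc C (f a * g b * x)) =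
      cyc C (diff0 C (f a * g b) * x) := by
    intro a b
    rcases hf with rfl | rfl <;> rcases hg with rfl | rfl <;>
      simp only [mul_assoc, diffHead_gen_mul, diffHead_curv_mul, cyc_gen_mul, cyc_curv_mul,
        der_gen_mul, der_curv_mul, map_mul, parity_gen, parity_curv, der_gen, der_curv, neg_mul,
        map_neg, sub_mul, add_mul, map_sub, map_add, parity_diff0Gen_gen,
        parity_diff0Gen_curv] <;> abel
  simp only [conv_eq_sum, Finset.sum_mul, map_sum, ← Finset.sum_add_distrib, key]

/-- `d` of a word begins with the two-letter products in `∂_0 a`, so `cyc_diffHead_conv` reduces the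
sum to `∂_0 ∂_0 a = 0`. -/
theorem cyc_diffHead_add (x : T C) : cyc C (diffHead C (diffHead C x)) +
    diffHead C (cyc C (diffHead C x)) = 0 := by
  suffices cyc C ∘ₗ diffHead C ∘ₗ diffHead C + diffHead C ∘ₗ cyc C ∘ₗ diffHead C = 0 from
    LinearMap.congr_fun this x
  apply ext_left
  · simp
  · intro h x _
    simp only [LinearMap.comp_apply, LinearMap.add_apply, LinearMap.zero_apply]
    rw [diffHead_gen_mul]
    have := diff0_diff0Gen_gen h
    rw [diff0Gen_gen, map_neg, neg_eq_zero] at this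
    have := cyc_diffHead_conv (gen C) (gen C) (.inl rfl) (.inl rfl) h x
    simp_all [diff0Gen_gen, ← neg_add]
  · intro h x _
    simp only [LinearMap.comp_apply, LinearMap.add_apply, LinearMap.zero_apply]
    rw [diffHead_curv_mul]
    have h0 := diff0_diff0Gen_curv h
    have h1 := cyc_diffHead_conv (gen C) (curv C) (.inl rfl) (.inr rfl) h x
    have h2 := cyc_diffHead_conv (curv C) (gen C) (.inr rfl) (.inl rfl) h x
    have h3 : cyc C (diff0 C (conv (curv C) (gen C) h) * x) -
        cyc C (diff0 C (conv (gen C) (curv C) h) * x) = 0 := by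
      rw [← map_sub, ← sub_mul, ← map_sub, ← diff0Gen_curv, h0, zero_mul, map_zero]
    rw [diff0Gen_curv, sub_mul]
    simp only [map_sub]
    rw [← h3, ← h1, ← h2]
    abel

/-- Expanding `b = ∂ + t d` with `∂ t = t ∂ + (t - 1) t d` leaves `t (∂ d + d ∂ - d²) + t (t d² + d
t d)`, and both brackets vanish. -/
theorem diffB_diffB (x : T C) : diffB C (diffB C x) = 0 := by
  have h1 := congrArg (cyc C) (diff_diffHead x)
  have h2 := congrArg (cyc C) (cyc_diffHead_add x)
  simp only [map_add, map_zero] at h1 h2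
  simp only [diffB_apply, map_add, diff_diff, diff_cyc]
  linear_combination (norm := abel) h1 + h2

end

section

variable {C : Type*} [AddCommGroup C] [Module ℂ C]

/-! ### Bidegrees of the operators -/

theorem map_mem_wordSpan {f : T C →ₗ[ℂ] T C} {R : ℕ × ℕ → Set (ℕ × ℕ)}
    (hf : ∀ l, f (word C l) ∈ wordSpan (R (bideg l))) {S S' : Set (ℕ × ℕ)}
    (h : ∀ p ∈ S, R p ⊆ S') {x : T C} (hx : x ∈ wordSpan S) : f x ∈ wordSpan S' := by
  suffices wordSpan S ≤ (wordSpan S').comap f from this hx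
  exact wordSpan_le.2 fun l hl => wordSpan_mono (h _ hl) (hf l)

theorem gen_mem (h : C) : gen C h ∈ wordSpan {(1, 0)} := by
  simpa [word_singleton] using
    word_mem_wordSpan (S := {(1, 0)}) (l := [Sum.inl h]) (by simp)

theorem curv_mem (h : C) : curv C h ∈ wordSpan {(0, 1)} := by
  simpa [word_singleton] using
    word_mem_wordSpan (S := {(0, 1)}) (l := [Sum.inr h]) (by simp)

theorem parity_mem {S : Set (ℕ × ℕ)} {x : T C} (hx : x ∈ wordSpan S) :
    parity C x ∈ wordSpan S := by
  suffices wordSpan S ≤ (wordSpan S).comap (parity C).toLinearMap from this hx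
  refine wordSpan_le.2 fun l hl => ?_
  rw [Submodule.mem_comap, AlgHom.toLinearMap_apply, parity_word]
  exact zsmul_mem (word_mem_wordSpan hl) _

theorem cyc_word_mem (l : List (C ⊕ C)) : cyc C (word C l) ∈ wordSpan {bideg l} := by
  cases l with
  | nil => simp
  | cons a l =>
    rw [cyc_word_cons]
    refine zsmul_mem (word_mem_wordSpan ?_) _
    rcases a with h | h <;> simp [add_comm]

theorem cyc_mem {S : Set (ℕ × ℕ)} {x : T C} (hx : x ∈ wordSpan S) : cyc C x ∈ wordSpan S :=
  map_mem_wordSpan (R := fun p => {p}) cyc_word_mem (fun p hp => by simpa using hp) hx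

theorem cyc_pow_mem {S : Set (ℕ × ℕ)} {x : T C} (hx : x ∈ wordSpan S) (i : ℕ) :
    (cyc C ^ i) x ∈ wordSpan S := by
  induction i with
  | zero => exact hx
  | succ i ih => rw [pow_succ', Module.End.mul_apply]; exact cyc_mem ih

theorem der_word_mem {δ : C × C →ₗ[ℂ] T C} {R : ℕ × ℕ → Set (ℕ × ℕ)}
    (h1 : ∀ h, δ (h, 0) ∈ wordSpan (R (1, 0))) (h2 : ∀ h, δ (0, h) ∈ wordSpan (R (0, 1)))
    (hR : ∀ p q r, q ∈ R p → q + r ∈ R (p + r)) (l : List (C ⊕ C)) :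
    der δ (word C l) ∈ wordSpan (R (bideg l)) := by
  induction l with
  | nil => simp
  | cons a l ih =>
    have hl : word C l ∈ wordSpan {bideg l} := word_mem_wordSpan rfl
    rw [word_cons]
    rcases a with h | h
    · simp only [Sum.elim_inl, der_gen_mul, bideg_inl_cons]
      refine sub_mem (mul_mem_wordSpan ?_ (h1 h) hl) (mul_mem_wordSpan ?_ (gen_mem h) ih)
      · rintro p hp _ rfl; exact hR _ _ _ hp
      · rintro _ rfl q hq; rw [add_comm, add_comm (1, 0)]; exact hR _ _ _ hq
    · simp only [Sum.elim_inr, der_curv_mul, bideg_inr_cons]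
      refine add_mem (mul_mem_wordSpan ?_ (h2 h) hl) (mul_mem_wordSpan ?_ (curv_mem h) ih)
      · rintro p hp _ rfl; exact hR _ _ _ hp
      · rintro _ rfl q hq; rw [add_comm, add_comm (0, 1)]; exact hR _ _ _ hq

theorem diffCurv_word_mem (l : List (C ⊕ C)) :
    der (curv C ∘ₗ LinearMap.fst ℂ C C) (word C l) ∈
      wordSpan {q | q.1 + 1 = (bideg l).1 ∧ q.2 = (bideg l).2 + 1} := by
  refine der_word_mem (R := fun p => {q | q.1 + 1 = p.1 ∧ q.2 = p.2 + 1})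
    (fun h => ?_) (fun h => ?_) ?_ l
  · exact wordSpan_mono (by rintro _ rfl; simp) (curv_mem h)
  · simp
  · rintro ⟨p, p'⟩ ⟨q, q'⟩ ⟨r, r'⟩ ⟨hq, hq'⟩
    simp only [Set.mem_ofPred_eq, Prod.mk_add_mk] at hq hq' ⊢
    omega

section Coalgebra

variable [Coalgebra ℂ C]

theorem conv_mem {f g : C →ₗ[ℂ] T C} {p q r : ℕ × ℕ} (hf : ∀ h, f h ∈ wordSpan {p})
    (hg : ∀ h, g h ∈ wordSpan {q}) (hr : p + q = r) (h : C) : conv f g h ∈ wordSpan {r} := by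
  rw [conv_eq_sum]
  refine sum_mem fun i _ => mul_mem_wordSpan ?_ (hf _) (hg _)
  rintro _ rfl _ rfl
  exact hr

theorem diff0Gen_gen_mem (h : C) : diff0Gen C (h, 0) ∈ wordSpan {(2, 0)} := by
  rw [diff0Gen_gen]
  exact neg_mem (conv_mem gen_mem gen_mem rfl h)

theorem diff0Gen_curv_mem (h : C) : diff0Gen C (0, h) ∈ wordSpan {(1, 1)} := by
  rw [diff0Gen_curv]
  exact sub_mem (conv_mem curv_mem gen_mem rfl h) (conv_mem gen_mem curv_mem rfl h)

theorem diff0_word_mem (l : List (C ⊕ C)) :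
    diff0 C (word C l) ∈ wordSpan {bideg l + (1, 0)} := by
  refine der_word_mem (R := fun p => {p + (1, 0)}) (fun h => ?_) (fun h => ?_) ?_ l
  · simpa using diff0Gen_gen_mem h
  · simpa using diff0Gen_curv_mem h
  rintro p _ r rfl
  exact add_right_comm _ _ _

theorem diffHead_word_mem (l : List (C ⊕ C)) :
    diffHead C (word C l) ∈ wordSpan {bideg l + (1, 0)} := by
  cases l with
  | nil => simp
  | cons a l =>
    have hl : word C l ∈ wordSpan {bideg l} := word_mem_wordSpan rfl
    rw [word_cons]
    rcases a with h | h
    · rw [letter, Sum.elim_inl, diffHead_gen_mul, bideg_inl_cons]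
      refine mul_mem_wordSpan ?_ (diff0Gen_gen_mem h) hl
      rintro _ rfl _ rfl; exact add_right_comm (1, 0) (1, 0) _
    · rw [letter, Sum.elim_inr, diffHead_curv_mul, bideg_inr_cons]
      refine mul_mem_wordSpan ?_ (diff0Gen_curv_mem h) hl
      rintro _ rfl _ rfl; exact add_right_comm (0, 1) (1, 0) _

/-- The possible bidegrees of the differential of an element of bidegree `p`. -/
def bidegStep (p : ℕ × ℕ) : Set (ℕ × ℕ) :=
  {q | (q.1 = p.1 + 1 ∧ q.2 = p.2) ∨ (q.1 + 1 = p.1 ∧ q.2 = p.2 + 1)}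

theorem diff_word_mem (l : List (C ⊕ C)) : diff C (word C l) ∈ wordSpan (bidegStep (bideg l)) := by
  rw [diff_eq_add]
  exact add_mem (wordSpan_mono (by rintro _ rfl; simp [bidegStep]) (diff0_word_mem l))
    (wordSpan_mono (fun q hq => Or.inr hq) (diffCurv_word_mem l))

theorem diffB_word_mem (l : List (C ⊕ C)) :
    diffB C (word C l) ∈ wordSpan (bidegStep (bideg l)) := by
  rw [diffB_apply]
  exact add_mem (diff_word_mem l)
    (cyc_mem (wordSpan_mono (by rintro _ rfl; simp [bidegStep]) (diffHead_word_mem l)))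

end Coalgebra

/-! ### Operators defined by the number of letters -/

/-- The operator given by `f p` on the span of the words with `p` letters. -/
def perLength (f : ℕ → Module.End ℂ (T C)) : T C →ₗ[ℂ] T C :=
  DirectSum.toModule ℂ ℕ (T C)
      (fun p => f p ∘ₗ
        ((LinearMap.range (TensorAlgebra.ι ℂ : C × C →ₗ[ℂ] T C)) ^ p).subtype) ∘ₗ
    (DirectSum.decomposeLinearEquiv
      (fun p : ℕ => (LinearMap.range (TensorAlgebra.ι ℂ : C × C →ₗ[ℂ] T C)) ^ p)).toLinearMap

theorem word_mem_range_pow (l : List (C ⊕ C)) :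
    word C l ∈ (LinearMap.range (TensorAlgebra.ι ℂ : C × C →ₗ[ℂ] T C)) ^ l.length := by
  induction l with
  | nil => exact Submodule.one_le.1 le_rfl
  | cons a l ih =>
    rw [word_cons, List.length_cons, pow_succ']
    refine Submodule.mul_mem_mul ?_ ih
    rcases a with h | h
    · exact ⟨(h, 0), rfl⟩
    · exact ⟨(0, h), rfl⟩

theorem perLength_word (f : ℕ → Module.End ℂ (T C)) (l : List (C ⊕ C)) :
    perLength f (word C l) = f l.length (word C l) := by
  simp only [perLength, LinearMap.comp_apply, LinearEquiv.coe_coe,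
    DirectSum.decomposeLinearEquiv_apply]
  rw [DirectSum.decompose_of_mem _ (word_mem_range_pow l)]
  erw [DirectSum.toModule_lof]
  rfl

theorem cycNorm_eq : cycNorm C = perLength fun p => ∑ i ∈ Finset.range p, cyc C ^ i := rfl

theorem cycNorm_word (l : List (C ⊕ C)) :
    cycNorm C (word C l) = ∑ i ∈ Finset.range l.length, (cyc C ^ i) (word C l) := by
  rw [cycNorm_eq, perLength_word, LinearMap.sum_apply]

theorem perLength_mem {f : ℕ → Module.End ℂ (T C)}
    (hf : ∀ p, ∀ S : Set (ℕ × ℕ), ∀ x ∈ wordSpan S, f p x ∈ wordSpan S) {S : Set (ℕ × ℕ)} {x : T C}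
    (hx : x ∈ wordSpan S) : perLength f x ∈ wordSpan S := by
  refine map_mem_wordSpan (R := fun p => {p}) (fun l => ?_) (fun p hp => by simpa using hp) hx
  rw [perLength_word]
  exact hf _ _ _ (word_mem_wordSpan rfl)

theorem perLength_cyc {f : ℕ → Module.End ℂ (T C)} (hf : ∀ p, Commute (f p) (cyc C)) (x : T C) :
    perLength f (cyc C x) = cyc C (perLength f x) := by
  suffices perLength f ∘ₗ cyc C = cyc C ∘ₗ perLength f from LinearMap.congr_fun this x
  refine ext_word fun l => ?_
  rw [LinearMap.comp_apply, LinearMap.comp_apply, perLength_word]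
  have := LinearMap.congr_fun (hf l.length) (word C l)
  simp only [Module.End.mul_apply] at this
  rw [← this]
  cases l with
  | nil => simp
  | cons a l =>
    rw [cyc_word_cons, map_zsmul, map_zsmul, perLength_word]
    simp

theorem cycNorm_mem {S : Set (ℕ × ℕ)} {x : T C} (hx : x ∈ wordSpan S) :
    cycNorm C x ∈ wordSpan S := by
  refine perLength_mem (fun p S x hx => ?_) hx
  rw [LinearMap.sum_apply]
  exact sum_mem fun i _ => cyc_pow_mem hx i

theorem commute_sum_pow (p : ℕ) : Commute (∑ i ∈ Finset.range p, cyc C ^ i) (cyc C) :=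
  Commute.sum_left _ _ _ fun i _ => (Commute.refl _).pow_left i

/-- On words with `p` letters `t^p = 1`, so `t` permutes the summands of `N`. -/
theorem cyc_cycNorm (x : T C) : cyc C (cycNorm C x) = cycNorm C x := by
  suffices cyc C ∘ₗ cycNorm C = cycNorm C from LinearMap.congr_fun this x
  refine ext_word fun l => ?_
  rw [LinearMap.comp_apply, cycNorm_word, map_sum]
  simp only [← Module.End.mul_apply, ← pow_succ']
  have h1 := Finset.sum_range_succ (fun i => (cyc C ^ i) (word C l)) l.length
  rw [Finset.sum_range_succ', cyc_pow_length_word, pow_zero] at h1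
  exact add_right_cancel h1

theorem cycNorm_cyc (x : T C) : cycNorm C (cyc C x) = cycNorm C x := by
  rw [cycNorm_eq, perLength_cyc commute_sum_pow, ← cycNorm_eq, cyc_cycNorm]

variable (C) in
/-- Division of a word by the number of its letters. -/
def lengthInv : T C →ₗ[ℂ] T C := perLength fun p => (p : ℂ)⁻¹ • 1

variable (C) in
/-- The contracting homotopy of the rows of the cyclic bicomplex. -/
def cycHomotopy : T C →ₗ[ℂ] T C :=
  perLength fun p => -((p : ℂ)⁻¹ • ∑ i ∈ Finset.range p, ∑ j ∈ Finset.range i, cyc C ^ j)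

theorem lengthInv_mem {S : Set (ℕ × ℕ)} {x : T C} (hx : x ∈ wordSpan S) :
    lengthInv C x ∈ wordSpan S :=
  perLength_mem (fun _ _ _ hx => Submodule.smul_mem _ _ hx) hx

theorem cycHomotopy_mem {S : Set (ℕ × ℕ)} {x : T C} (hx : x ∈ wordSpan S) :
    cycHomotopy C x ∈ wordSpan S := by
  refine perLength_mem (fun p S x hx => ?_) hx
  simp only [LinearMap.neg_apply, LinearMap.smul_apply, LinearMap.sum_apply]
  exact neg_mem (Submodule.smul_mem _ _ (sum_mem fun i _ => sum_mem fun j _ => cyc_pow_mem hx j))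

theorem cycHomotopy_cyc (x : T C) : cycHomotopy C (cyc C x) = cyc C (cycHomotopy C x) := by
  refine perLength_cyc (fun p => ?_) x
  have h : Commute (∑ i ∈ Finset.range p, ∑ j ∈ Finset.range i, cyc C ^ j) (cyc C) :=
    Commute.sum_left _ _ _ fun i _ => commute_sum_pow i
  exact (h.smul_left _).neg_left

theorem lengthInv_cyc (x : T C) : lengthInv C (cyc C x) = cyc C (lengthInv C x) :=
  perLength_cyc (fun _ => (Commute.one_left _).smul_left _) x

theorem lengthInv_cycNorm (x : T C) : lengthInv C (cycNorm C x) = cycNorm C (lengthInv C x) := by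
  suffices lengthInv C ∘ₗ cycNorm C = cycNorm C ∘ₗ lengthInv C from LinearMap.congr_fun this x
  have h (i : ℕ) (x : T C) : lengthInv C ((cyc C ^ i) x) = (cyc C ^ i) (lengthInv C x) := by
    induction i with
    | zero => rfl
    | succ i ih => simp only [pow_succ', Module.End.mul_apply, lengthInv_cyc, ih]
  refine ext_word fun l => ?_
  rw [LinearMap.comp_apply, LinearMap.comp_apply, cycNorm_word, map_sum]
  simp only [h]
  rw [lengthInv, perLength_word, LinearMap.smul_apply, map_smul, Module.End.one_apply,
    cycNorm_word, Finset.smul_sum]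
  simp only [map_smul]

/-- The contracting homotopy of the rows: `1 = N p⁻¹ + (t - 1) θ` on words of positive length. -/
theorem cycNorm_lengthInv_add {S : Set (ℕ × ℕ)} (hS : ∀ p ∈ S, 0 < p.1 + p.2) {x : T C}
    (hx : x ∈ wordSpan S) :
    cycNorm C (lengthInv C x) + (cyc C (cycHomotopy C x) - cycHomotopy C x) = x := by
  refine eqOn_wordSpan (f := cycNorm C ∘ₗ lengthInv C + (cyc C ∘ₗ cycHomotopy C - cycHomotopy C))
    (g := LinearMap.id) (fun l hl => ?_) hx
  have hl : (l.length : ℂ) ≠ 0 := by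
    rw [length_eq_bideg]
    exact_mod_cast (hS _ hl).ne'
  -- `(t - 1)(1 + ⋯ + t^{i-1}) = t^i - 1`. Averaging over `i < p` gives `N/p - 1`; the division
  -- requires words of positive length.
  have key (i : ℕ) : ∑ j ∈ Finset.range i, cyc C ((cyc C ^ j) (word C l)) -
      ∑ j ∈ Finset.range i, (cyc C ^ j) (word C l) = (cyc C ^ i) (word C l) - word C l := by
    rw [← Finset.sum_sub_distrib]
    simp only [← Module.End.mul_apply, ← pow_succ']
    rw [Finset.sum_range_sub (fun j => (cyc C ^ j) (word C l)), pow_zero, Module.End.one_apply]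
  simp only [LinearMap.add_apply, LinearMap.sub_apply, LinearMap.comp_apply, lengthInv,
    cycHomotopy, perLength_word, LinearMap.id_apply, LinearMap.neg_apply, LinearMap.smul_apply,
    LinearMap.sum_apply, map_neg, map_smul, Module.End.one_apply, cycNorm_word, map_sum (cyc C)]
  rw [← neg_sub', ← smul_sub, ← Finset.sum_sub_distrib]
  simp only [key]
  simp [Finset.sum_sub_distrib, smul_sub, hl, ← Nat.cast_smul_eq_nsmul ℂ]

end

section

/-- Cutting a word between its letters `ω` factors it through two powers of the curvature ideal. -/
theorem exists_split {C : Type*} (l : List (C ⊕ C)) (m n : ℕ) (h : m + n ≤ (bideg l).2) :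
    ∃ l₁ l₂, l = l₁ ++ l₂ ∧ (bideg l₁).2 = m ∧ n ≤ (bideg l₂).2 := by
  induction l generalizing m with
  | nil => exact ⟨[], [], rfl, by simp at h ⊢; omega, by simp at h ⊢; omega⟩
  | cons a l ih =>
    rcases a with c | c
    · obtain ⟨l₁, l₂, rfl, h₁, h₂⟩ := ih m (by simpa using h)
      exact ⟨Sum.inl c :: l₁, l₂, rfl, by simpa using h₁, h₂⟩
    · cases m with
      | zero => exact ⟨[], Sum.inr c :: l, rfl, rfl, by simpa using h⟩
      | succ m =>
        obtain ⟨l₁, l₂, rfl, h₁, h₂⟩ := ih m (by simp at h; omega)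
        exact ⟨Sum.inr c :: l₁, l₂, rfl, by simp [h₁]; omega, h₂⟩

variable {C : Type*} [AddCommGroup C] [Module ℂ C]

theorem cycNorm_eq_sum {p : ℕ} {x : T C} (hx : x ∈ wordSpan {q | q.1 + q.2 = p}) :
    cycNorm C x = ∑ i ∈ Finset.range p, (cyc C ^ i) x := by
  have := eqOn_wordSpan (f := cycNorm C) (g := ∑ i ∈ Finset.range p, cyc C ^ i)
    (fun l hl => by
      rw [cycNorm_word, LinearMap.sum_apply, length_eq_bideg,
        show (bideg l).1 + (bideg l).2 = p from hl])
    hx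
  rwa [LinearMap.sum_apply] at this

/-! ### The norm intertwines `∂` and `b` -/

section Norm

variable [Coalgebra ℂ C]

variable (C) in
/-- The sum `∑_{i<p} t^{p-1-i} t d t^i`, where `d` is `∂_0` on the first letter. -/
def cycFaces : ℕ → (T C →ₗ[ℂ] T C)
  | 0 => 0
  | p + 1 => cyc C ∘ₗ cycFaces p + cyc C ∘ₗ diffHead C ∘ₗ (cyc C ^ p)

theorem cycFaces_succ (p : ℕ) (x : T C) : cycFaces C (p + 1) x =
    cyc C (cycFaces C p x) + cyc C (diffHead C ((cyc C ^ p) x)) := rfl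

theorem cycFaces_succ' (p : ℕ) (x : T C) : cycFaces C (p + 1) x =
    cycFaces C p (cyc C x) + (cyc C ^ (p + 1)) (diffHead C x) := by
  induction p with
  | zero => simp [cycFaces]
  | succ p ih =>
    rw [cycFaces_succ, ih, cycFaces_succ, map_add, ← Module.End.mul_apply (cyc C ^ p),
      ← pow_succ, pow_succ' _ (p + 1), Module.End.mul_apply]
    abel

/-- `cycFaces` collects the failure of the powers of `t` to commute with `∂`. -/
theorem diff_cyc_pow (p : ℕ) (x : T C) : diff C ((cyc C ^ p) x) =
    (cyc C ^ p) (diff C x) + cyc C (cycFaces C p x) - cycFaces C p x := by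
  induction p with
  | zero => simp [cycFaces]
  | succ p ih =>
    rw [pow_succ', Module.End.mul_apply, diff_cyc, ih, Module.End.mul_apply, cycFaces_succ,
      map_sub, map_add, map_add]
    abel

/-- With `F_i = cycFaces i` and `F_{i+1} = t F_i + t d t^i`, the formula for `∂ t^i` becomes `b t^i
= t^i ∂ + F_{i+1} - F_i`, and the sum telescopes. -/
theorem diffB_sum_cyc_pow (p : ℕ) (x : T C) :
    diffB C (∑ i ∈ Finset.range p, (cyc C ^ i) x) =
      ∑ i ∈ Finset.range p, (cyc C ^ i) (diff C x) + cycFaces C p x := by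
  induction p with
  | zero => simp [cycFaces]
  | succ p ih =>
    rw [Finset.sum_range_succ, map_add, ih, Finset.sum_range_succ, diffB_apply, diff_cyc_pow,
      cycFaces_succ]
    abel

/-- Each turn brings the next letter of the prefix to the front, where `d` differentiates it. After
the whole prefix has passed, the Leibniz rule for `∂_0` has been reproduced. -/
theorem cycFaces_word_mul (l : List (C ⊕ C)) (x : T C) : cycFaces C l.length (word C l * x) =
    (cyc C ^ l.length) (diff0 C (word C l) * x) := by
  induction l generalizing x with
  | nil => simp [cycFaces]
  | cons a l ih =>
    have ih' (y : T C) : cycFaces C l.length (parity C (word C l) * y) =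
        (cyc C ^ l.length) (diff0 C (parity C (word C l)) * y) := by
      rw [parity_word, smul_mul_assoc, map_zsmul, ih, map_zsmul, smul_mul_assoc, map_zsmul]
    rw [word_cons, mul_assoc, List.length_cons, cycFaces_succ']
    rcases a with h | h
    · rw [letter, Sum.elim_inl, cyc_gen_mul, map_mul (parity C), mul_assoc, ih',
        der_parity parity_diff0Gen_gen parity_diff0Gen_curv, diffHead_gen_mul, der_gen_mul, sub_mul,
        mul_assoc, mul_assoc, map_sub, pow_succ, Module.End.mul_apply, Module.End.mul_apply,
        cyc_gen_mul, map_mul (parity C), mul_assoc, neg_mul, map_neg]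
      abel
    · rw [letter, Sum.elim_inr, cyc_curv_mul, mul_assoc, ih, diffHead_curv_mul, der_curv_mul,
        add_mul, mul_assoc, mul_assoc, map_add, pow_succ, Module.End.mul_apply,
        Module.End.mul_apply, cyc_curv_mul, mul_assoc]
      abel

/-- On a word of length `p`, `diffB_sum_cyc_pow` gives `∑_{i<p} t^i ∂` plus the extra term `t^p
∂_0`. The part `∂_0` raises the length to `p + 1`, whose norm has exactly this one further summand;
the part `∂ - ∂_0` keeps the length. -/
theorem diffB_cycNorm (x : T C) : diffB C (cycNorm C x) = cycNorm C (diff C x) := by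
  suffices diffB C ∘ₗ cycNorm C = cycNorm C ∘ₗ diff C from LinearMap.congr_fun this x
  refine ext_word fun l => ?_
  have h := cycFaces_word_mul l 1
  rw [mul_one, mul_one] at h
  have h0 : diff0 C (word C l) ∈ wordSpan {q | q.1 + q.2 = l.length + 1} :=
    wordSpan_mono (by rintro _ rfl; simp [length_eq_bideg]; ring) (diff0_word_mem l)
  have h1 : diffCurv C (word C l) ∈ wordSpan {q | q.1 + q.2 = l.length} :=
    wordSpan_mono (by rintro q ⟨hq, hq'⟩; simp [length_eq_bideg]; omega) (diffCurv_word_mem l)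
  rw [LinearMap.comp_apply, LinearMap.comp_apply, cycNorm_word, diffB_sum_cyc_pow, h, diff_eq_add,
    map_add, cycNorm_eq_sum h0, cycNorm_eq_sum h1, Finset.sum_range_succ]
  simp only [map_add, Finset.sum_add_distrib]
  abel

end Norm

/-! ### The ideals as spans of words -/

theorem weil_eq : weil C = wordSpan {p | 0 < p.1 + p.2} := by
  simp only [weil, wordSpan, ne_nil_iff_bideg]; rfl

theorem weilDeg_eq (k : ℤ) :
    weilDeg C k = wordSpan {p | 0 < p.1 + p.2 ∧ (p.1 : ℤ) + 2 * p.2 = k} := by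
  simp only [weilDeg, wordSpan, ne_nil_iff_bideg, wordDeg_eq_bideg, ← and_assoc]; rfl

theorem curvIdeal_eq : curvIdeal C = wordSpan {p | 1 ≤ p.2} := by
  apply le_antisymm
  · rw [curvIdeal, ← wordSpan_univ]
    refine Submodule.mul_le.2 fun x hx y hy => mul_mem_wordSpan (S := {p | 1 ≤ p.2}) ?_ ?_ hy
    · rintro p hp q -
      exact le_add_right (show 1 ≤ p.2 from hp)
    · revert x
      rw [← SetLike.le_def]
      refine Submodule.mul_le.2 fun x hx y hy => mul_mem_wordSpan (S' := {(0, 1)}) ?_ hx ?_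
      · rintro p hp _ rfl
        exact Nat.le_add_left _ _
      · obtain ⟨h, rfl⟩ := hy
        exact curv_mem h
  · refine wordSpan_le.2 fun l hl => ?_
    obtain ⟨l₁, l₂, rfl, -, h₂⟩ := exists_split l 0 1 (by simpa using hl)
    clear hl
    -- Leading letters `h` pass to the left factor until a letter `ω` comes first.
    induction l₂ generalizing l₁ with
    | nil => simp at h₂
    | cons a l ih =>
      rcases a with c | c
      · rw [List.append_cons]
        exact ih (l₁ ++ [Sum.inl c]) (by simpa using h₂)
      · rw [word_append, word_cons, ← mul_assoc]
        exact Submodule.mul_mem_mul (Submodule.mul_mem_mul trivial ⟨c, rfl⟩) trivial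

theorem curvPow_succ_eq (m : ℕ) : curvPow C (m + 1) = wordSpan {p | m + 1 ≤ p.2} := by
  rw [curvPow, curvIdeal_eq]
  induction m with
  | zero => simp
  | succ m ih =>
    rw [pow_succ, ih]
    apply le_antisymm
    · refine Submodule.mul_le.2 fun x hx y hy => mul_mem_wordSpan ?_ hx hy
      intro p hp q hq
      exact Nat.add_le_add hp hq
    · refine wordSpan_le.2 fun l hl => ?_
      obtain ⟨l₁, l₂, rfl, h₁, h₂⟩ := exists_split l (m + 1) 1 hl
      rw [word_append]
      exact Submodule.mul_mem_mul (word_mem_wordSpan h₁.ge) (word_mem_wordSpan h₂)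

theorem curvPow_eq (m : ℕ) : curvPow C m = wordSpan {p | 0 < p.1 + p.2 ∧ m ≤ p.2} := by
  cases m with
  | zero => rw [curvPow, weil_eq]; congr; ext; simp
  | succ m => rw [curvPow_succ_eq]; congr 1; ext; simp; omega

/-- The bidegrees in `S` of positive length and total degree `k`. -/
def atDeg (S : Set (ℕ × ℕ)) (k : ℤ) : Set (ℕ × ℕ) :=
  S ∩ {p | 0 < p.1 + p.2 ∧ (p.1 : ℤ) + 2 * p.2 = k}

theorem gr_wordSpan (S : Set (ℕ × ℕ)) (k : ℤ) : gr C (wordSpan S) k = wordSpan (atDeg S k) := by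
  rw [gr, weilDeg_eq, wordSpan_inf, atDeg]

/-! ### Commutators and the cyclic permutation -/

theorem part_cyc (S : Set (ℕ × ℕ)) (x : T C) : part S (cyc C x) = cyc C (part S x) := by
  classical
  suffices part S ∘ₗ cyc C = cyc C ∘ₗ part S from LinearMap.congr_fun this x
  refine ext_word fun l => ?_
  rw [LinearMap.comp_apply, LinearMap.comp_apply, part_word]
  cases l with
  | nil => split_ifs <;> simp
  | cons a l =>
    rw [cyc_word_cons, map_zsmul, part_word]
    have : bideg (l ++ [a]) = bideg (a :: l) := by rcases a with c | c <;> simp [add_comm]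
    rw [this]
    split_ifs
    · rw [cyc_word_cons]
    · simp

/-- The image of `t - 1` on the span of the words with bidegree in `S`. -/
def cycComm (S : Set (ℕ × ℕ)) : Submodule ℂ (T C) := (wordSpan S).map (cyc C - 1)

theorem mem_cycComm {S : Set (ℕ × ℕ)} {x : T C} :
    x ∈ cycComm S ↔ ∃ y ∈ wordSpan S, cyc C y - y = x := Iff.rfl

theorem cycComm_le (S : Set (ℕ × ℕ)) : (cycComm S : Submodule ℂ (T C)) ≤ wordSpan S := by
  rintro _ ⟨x, hx, rfl⟩
  exact sub_mem (cyc_mem hx) hx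

theorem part_mem_cycComm (S : Set (ℕ × ℕ)) {R : Set (ℕ × ℕ)} {x : T C} (hx : x ∈ cycComm R) :
    part S x ∈ cycComm (R ∩ S) := by
  obtain ⟨y, hy, rfl⟩ := mem_cycComm.1 hx
  exact mem_cycComm.2 ⟨part S y, part_mem S hy, by rw [map_sub, part_cyc]⟩

theorem cyc_pow_sub_mem {S : Set (ℕ × ℕ)} {x : T C} (hx : x ∈ wordSpan S) (i : ℕ) :
    (cyc C ^ i) x - x ∈ cycComm S := by
  refine mem_cycComm.2
    ⟨∑ j ∈ Finset.range i, (cyc C ^ j) x, sum_mem fun j _ => cyc_pow_mem hx j, ?_⟩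
  rw [map_sum, ← Finset.sum_sub_distrib]
  simp only [← Module.End.mul_apply, ← pow_succ']
  rw [Finset.sum_range_sub (fun j => (cyc C ^ j) x), pow_zero, Module.End.one_apply]

/-- `part S` commutes with `t`, so it sends a preimage under `t - 1` to a preimage inside the
smaller span. This makes the commutator quotient of an ideal inject into that of `W`. -/
theorem wordSpan_inf_cycComm (S R : Set (ℕ × ℕ)) :
    (wordSpan S ⊓ cycComm R : Submodule ℂ (T C)) = cycComm (R ∩ S) := by
  apply le_antisymm
  · rintro x ⟨hS, hR⟩
    rw [← part_eq_self hS]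
    exact part_mem_cycComm S hR
  · exact le_inf ((cycComm_le _).trans (wordSpan_mono Set.inter_subset_right))
      (Submodule.map_mono (wordSpan_mono Set.inter_subset_left))

theorem word_comm_mem {S : Set (ℕ × ℕ)} (u v : List (C ⊕ C)) (h : bideg u + bideg v ∈ S) :
    word C u * word C v - sgn (wordDeg C u * wordDeg C v) • (word C v * word C u) ∈ cycComm S := by
  have := cyc_pow_sub_mem (C := C) (word_mem_wordSpan (l := u ++ v) (S := S) (by simpa)) u.length
  rw [cyc_pow_word_append] at this
  rw [← word_append, ← word_append]
  simpa using neg_mem this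

theorem gr_gradedComm_le {P Q S : Set (ℕ × ℕ)} (h : ∀ p ∈ P, ∀ q ∈ Q, p + q ∈ S) :
    gradedComm C (wordSpan P) (wordSpan Q) ≤ cycComm S := by
  rw [gradedComm, Submodule.span_le]
  rintro _ ⟨i, j, x, hx, y, hy, rfl⟩
  rw [gr_wordSpan] at hx hy
  change x * y - sgn (i * j) • (y * x) ∈ cycComm S
  let f : T C →ₗ[ℂ] T C →ₗ[ℂ] T C :=
    LinearMap.mul ℂ (T C) - sgn (i * j) • (LinearMap.mul ℂ (T C)).flip
  suffices wordSpan (atDeg P i) ≤ (cycComm S).comap (f.flip y) from this hx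
  refine wordSpan_le.2 fun u hu => ?_
  suffices wordSpan (atDeg Q j) ≤ (cycComm S).comap (f (word C u)) from this hy
  refine wordSpan_le.2 fun v hv => ?_
  have := word_comm_mem u v (h _ hu.1 _ hv.1)
  rw [wordDeg_eq_bideg, wordDeg_eq_bideg, hu.2.2, hv.2.2] at this
  exact this

theorem word_comm_mem_gradedComm {P Q : Set (ℕ × ℕ)} (u v : List (C ⊕ C)) (hu : bideg u ∈ P)
    (hv : bideg v ∈ Q) (hu' : u ≠ []) (hv' : v ≠ []) :
    word C u * word C v - sgn (wordDeg C u * wordDeg C v) • (word C v * word C u) ∈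
      gradedComm C (wordSpan P) (wordSpan Q) := by
  refine Submodule.subset_span ⟨wordDeg C u, wordDeg C v, _, ?_, _, ?_, rfl⟩ <;>
    rw [gr_wordSpan] <;> refine word_mem_wordSpan ⟨‹_›, (ne_nil_iff_bideg _).1 ‹_›, ?_⟩ <;>
    rw [wordDeg_eq_bideg]

theorem gradedComm_weil : gradedComm C (weil C) (weil C) = cycComm {p | 0 < p.1 + p.2} := by
  apply le_antisymm
  · rw [weil_eq]
    exact gr_gradedComm_le fun p hp q hq => by simp at hp hq ⊢; omega
  · rw [cycComm, Submodule.map_le_iff_le_comap, weil_eq]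
    refine wordSpan_le.2 fun l hl => ?_
    rcases l with - | ⟨a, l⟩
    · simp at hl
    rw [Submodule.mem_comap, LinearMap.sub_apply, cyc_word_cons, Module.End.one_apply]
    -- A one-letter word is fixed by `t`. A longer one gives the commutator of its first letter with
    -- the rest.
    by_cases hl0 : l = []
    · subst hl0
      simp [wordDeg]
    have := word_comm_mem_gradedComm (P := {p | 0 < p.1 + p.2}) (Q := {p | 0 < p.1 + p.2}) [a] l
      ((ne_nil_iff_bideg _).1 (by simp)) ((ne_nil_iff_bideg _).1 hl0) (by simp) hl0
    rw [← word_append, ← word_append] at this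
    simpa using neg_mem this

theorem gradedComm_curvPow (n : ℕ) : gradedComm C (curvPow C 1) (curvPow C n) =
    cycComm {p | 0 < p.1 + p.2 ∧ n + 1 ≤ p.2} := by
  rw [curvPow_eq, curvPow_eq]
  set P : Set (ℕ × ℕ) := {p | 0 < p.1 + p.2 ∧ 1 ≤ p.2} with hP
  set Q : Set (ℕ × ℕ) := {p | 0 < p.1 + p.2 ∧ n ≤ p.2} with hQ
  apply le_antisymm
  · exact gr_gradedComm_le fun p hp q hq => by simp [hP, hQ] at hp hq ⊢; omega
  have key (u v : List (C ⊕ C)) (hu : 1 ≤ (bideg u).2) (hv : n ≤ (bideg v).2) (hv' : v ≠ []) :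
      word C (u ++ v) - sgn (wordDeg C u * wordDeg C v) • word C (v ++ u) ∈
        gradedComm C (wordSpan P) (wordSpan Q) := by
    rw [word_append, word_append]
    refine word_comm_mem_gradedComm u v ⟨by omega, hu⟩ ⟨(ne_nil_iff_bideg _).1 hv', hv⟩ ?_ hv'
    rintro rfl
    simp at hu
  rw [cycComm, Submodule.map_le_iff_le_comap]
  refine wordSpan_le.2 fun l hl => ?_
  rcases l with - | ⟨a, l⟩
  · simp at hl
  rw [Submodule.mem_comap, LinearMap.sub_apply, cyc_word_cons, Module.End.one_apply]
  by_cases hl0 : l = []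
  · subst hl0
    simp [wordDeg]
  have hl2 := hl.2
  rcases a with c | c
  · rw [bideg_inl_cons, Prod.snd_add, zero_add] at hl2
    -- For `n = 0` the letter `h` lies in `I^0 = W`, so one commutator with `l ∈ I` suffices.
    rcases Nat.eq_zero_or_pos n with hn | hn
    · have := zsmul_mem (key l [Sum.inl c] (by omega) (by omega) (by simp))
        (sgn (wordDeg C [Sum.inl c] * wordDeg C l))
      rw [smul_sub, smul_smul, mul_comm (wordDeg C l), sgn_mul_self, one_smul] at this
      exact this
    -- Now `h` lies in neither factor. With `v₁ ∈ I` and `v₂ ∈ I^n` it is carried around in two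
    -- steps: `[h v₁, v₂]` leads from `h v₁ v₂` to `v₂ h v₁`, and `[v₁, v₂ h]` from there to `v₁ v₂
    -- h`.
    · obtain ⟨v₁, v₂, rfl, h₁, h₂⟩ := exists_split l 1 n (by omega)
      have hv₂ : v₂ ≠ [] := by
        rintro rfl
        simp at h₂
        omega
      have k₁ := key (Sum.inl c :: v₁) v₂ (by simp [h₁]) h₂ hv₂
      have k₂ := zsmul_mem (key v₁ (v₂ ++ [Sum.inl c]) h₁.ge (by simpa using h₂) (by simp))
        (sgn (wordDeg C [Sum.inl c] * wordDeg C (v₁ ++ v₂)))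
      have e : wordDeg C (Sum.inl c :: v₁) = wordDeg C [Sum.inl c] + wordDeg C v₁ :=
        wordDeg_append [Sum.inl c] v₁
      rw [smul_sub, smul_smul, ← sgn_add, wordDeg_append, wordDeg_append,
        show wordDeg C [Sum.inl c] * (wordDeg C v₁ + wordDeg C v₂) +
          wordDeg C v₁ * (wordDeg C v₂ + wordDeg C [Sum.inl c]) =
          (wordDeg C [Sum.inl c] + wordDeg C v₁) * wordDeg C v₂ +
            2 * (wordDeg C [Sum.inl c] * wordDeg C v₁) by ring, sgn_add, sgn_two_mul, mul_one,
        ← e] at k₂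
      have := sub_mem k₂ k₁
      simp only [List.append_assoc, List.cons_append, List.nil_append,
        sub_sub_sub_cancel_right] at this
      rw [wordDeg_append, List.append_assoc]
      exact this
  · have := key [Sum.inr c] l (by simp) (by simpa [add_comm 1] using hl2) hl0
    simpa using neg_mem this

end

section

/-! ### Maps induced in cohomology -/

section Induced

variable {X Y : Type*} [AddCommGroup X] [Module ℂ X] [AddCommGroup Y] [Module ℂ Y]
  {D : X →ₗ[ℂ] X} {A B : ℤ → Submodule ℂ X} {k : ℤ}
  {D' : Y →ₗ[ℂ] Y} {A' B' : ℤ → Submodule ℂ Y} {l : ℤ} {f : X →ₗ[ℂ] Y}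

theorem Coh.cls_eq_cls {x y : ↥(cocycles D A B k)} :
    Coh.cls D A B k x = Coh.cls D A B k y ↔ (x : X) - y ∈ coboundaries D A B k :=
  Submodule.Quotient.eq _

theorem Coh.cls_surjective : Function.Surjective (Coh.cls D A B k) := Submodule.mkQ_surjective _

theorem exists_induces (hc : ∀ x ∈ cocycles D A B k, f x ∈ cocycles D' A' B' l)
    (hb : ∀ x ∈ cocycles D A B k, x ∈ coboundaries D A B k → f x ∈ coboundaries D' A' B' l) :
    ∃ φ, Induces D A B k D' A' B' l f φ := by
  refine ⟨Submodule.mapQ _ _ (f.restrict hc) ?_, fun x => ⟨hc x x.2, rfl⟩⟩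
  intro x hx
  exact hb x x.2 hx

theorem Induces.bijective {φ : Coh D A B k →ₗ[ℂ] Coh D' A' B' l}
    (h : Induces D A B k D' A' B' l f φ)
    (hi : ∀ x ∈ cocycles D A B k, f x ∈ coboundaries D' A' B' l → x ∈ coboundaries D A B k)
    (hs : ∀ y ∈ cocycles D' A' B' l, ∃ x ∈ cocycles D A B k, f x - y ∈ coboundaries D' A' B' l) :
    Function.Bijective φ := by
  constructor
  · rw [← LinearMap.ker_eq_bot, LinearMap.ker_eq_bot']
    intro α hα
    obtain ⟨x, rfl⟩ := Coh.cls_surjective α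
    obtain ⟨hx, e⟩ := h x
    rw [hα, ← map_zero (Coh.cls D' A' B' l), eq_comm, Coh.cls_eq_cls] at e
    rw [← map_zero (Coh.cls D A B k), Coh.cls_eq_cls]
    simpa using hi x x.2 (by simpa using e)
  · intro β
    obtain ⟨y, rfl⟩ := Coh.cls_surjective β
    obtain ⟨x, hx, e⟩ := hs y y.2
    obtain ⟨hx', e'⟩ := h ⟨x, hx⟩
    exact ⟨_, e'.trans (Coh.cls_eq_cls.2 e)⟩

theorem exists_equiv_induces (hc : ∀ x ∈ cocycles D A B k, f x ∈ cocycles D' A' B' l)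
    (hb : ∀ x ∈ cocycles D A B k, x ∈ coboundaries D A B k → f x ∈ coboundaries D' A' B' l)
    (hi : ∀ x ∈ cocycles D A B k, f x ∈ coboundaries D' A' B' l → x ∈ coboundaries D A B k)
    (hs : ∀ y ∈ cocycles D' A' B' l, ∃ x ∈ cocycles D A B k, f x - y ∈ coboundaries D' A' B' l) :
    ∃ φ : Coh D A B k ≃ₗ[ℂ] Coh D' A' B' l, Induces D A B k D' A' B' l f φ.toLinearMap := by
  obtain ⟨φ, h⟩ := exists_induces hc hb
  exact ⟨LinearEquiv.ofBijective φ (h.bijective hi hs), h⟩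

theorem mem_cocycles {x : X} : x ∈ cocycles D A B k ↔ x ∈ A k ∧ D x ∈ B (k + 1) := Iff.rfl

theorem mem_coboundaries {x : X} :
    x ∈ coboundaries D A B k ↔ ∃ y ∈ A (k - 1), x - D y ∈ B k := by
  rw [coboundaries, Submodule.mem_sup]
  constructor
  · rintro ⟨b, hb, _, ⟨y, hy, rfl⟩, rfl⟩
    exact ⟨y, hy, by simpa using hb⟩
  · rintro ⟨y, hy, h⟩
    exact ⟨_, h, _, ⟨y, hy, rfl⟩, by simp⟩

end Induced

variable {C : Type*} [AddCommGroup C] [Module ℂ C]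

/-! ### The rows of the cyclic bicomplex -/

/-- The contracting homotopy preserves bidegrees, so the rows remain exact modulo any span of words.
-/
theorem exact_cycNorm {S R : Set (ℕ × ℕ)} (hS : ∀ p ∈ S, 0 < p.1 + p.2) {x : T C}
    (hx : x ∈ wordSpan S) (hN : cycNorm C x ∈ wordSpan R) :
    ∃ y ∈ wordSpan S, x - (cyc C y - y) ∈ wordSpan R := by
  refine ⟨_, cycHomotopy_mem hx, ?_⟩
  have h := cycNorm_lengthInv_add hS hx
  rw [← eq_sub_iff_add_eq, ← lengthInv_cycNorm] at h
  rw [← h]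
  exact lengthInv_mem hN

theorem exact_cyc {S R : Set (ℕ × ℕ)} (hS : ∀ p ∈ S, 0 < p.1 + p.2) {x : T C}
    (hx : x ∈ wordSpan S) (ht : cyc C x - x ∈ wordSpan R) :
    ∃ y ∈ wordSpan S, x - cycNorm C y ∈ wordSpan R := by
  refine ⟨_, lengthInv_mem hx, ?_⟩
  have h := cycNorm_lengthInv_add hS hx
  rw [add_comm, ← eq_sub_iff_add_eq, ← cycHomotopy_cyc, ← map_sub] at h
  rw [← h]
  exact cycHomotopy_mem ht

/-! ### The total complex -/

theorem mem_tot {A : ℤ → Submodule ℂ (T C)} {m : ℤ} {x : ℕ → T C} :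
    x ∈ tot C A m ↔ ∀ p : ℕ, x p ∈ A (m - p) := by
  simp [tot, Submodule.mem_pi]

theorem horiz_horiz (p : ℕ) (x : T C) : horiz C (p + 1) (horiz C p x) = 0 := by
  unfold horiz
  by_cases h : Even p
  · simp [Nat.even_add_one, h, cycNorm_cyc]
  · simp [Nat.even_add_one, h, cyc_cycNorm]

theorem augment_zero (x : T C) : augment C x 0 = cycNorm C x := by simp [augment]

theorem augment_succ (x : T C) (p : ℕ) : augment C x (p + 1) = 0 := by simp [augment]

theorem shift_mem_tot {A : ℤ → Submodule ℂ (T C)} {m : ℤ} {x : ℕ → T C} (hx : x ∈ tot C A m) :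
    shift C x ∈ tot C A (m + 2) := by
  rw [mem_tot] at hx ⊢
  rintro (- | - | p)
  · exact zero_mem _
  · exact zero_mem _
  · rw [show m + 2 - ((p + 1 + 1 : ℕ) : ℤ) = m - p by push_cast; ring]
    exact hx p

variable [Coalgebra ℂ C]

theorem totDiff_zero (x : ℕ → T C) : totDiff C x 0 = diffB C (x 0) := by
  simp [totDiff, vert]

theorem totDiff_succ (x : ℕ → T C) (p : ℕ) :
    totDiff C x (p + 1) = vert C (p + 1) (x (p + 1)) + horiz C p (x p) := by
  simp [totDiff]

theorem vert_vert (p : ℕ) (x : T C) : vert C p (vert C p x) = 0 := by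
  unfold vert
  split_ifs
  · exact diffB_diffB x
  · simp [diff_diff]

theorem vert_horiz (p : ℕ) (x : T C) :
    vert C (p + 1) (horiz C p x) + horiz C p (vert C p x) = 0 := by
  unfold horiz vert
  by_cases h : Even p
  · have := cyc_sub_diffB x
    simp [Nat.even_add_one, h, this]
  · simp [Nat.even_add_one, h, diffB_cycNorm]

theorem totDiff_totDiff (x : ℕ → T C) : totDiff C (totDiff C x) = 0 := by
  funext p
  rcases p with - | p
  · rw [totDiff_zero, totDiff_zero, diffB_diffB]; rfl
  rw [totDiff_succ, totDiff_succ, map_add, vert_vert, zero_add]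
  rcases p with - | p
  · rw [totDiff_zero]
    simpa [vert] using vert_horiz 0 (x 0)
  · rw [totDiff_succ, map_add, horiz_horiz, add_zero, vert_horiz]; rfl

theorem totDiff_augment (x : T C) : totDiff C (augment C x) = augment C (diff C x) := by
  funext p
  rcases p with - | p
  · rw [totDiff_zero, augment_zero, augment_zero, diffB_cycNorm]
  rw [totDiff_succ, augment_succ, augment_succ, map_zero, zero_add]
  rcases p with - | p
  · simp [augment_zero, horiz, cyc_cycNorm]
  · rw [augment_succ, map_zero]

theorem totDiff_shift (x : ℕ → T C) : totDiff C (shift C x) = shift C (totDiff C x) := by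
  funext p
  rcases p with - | - | - | p
  · simp [totDiff_zero, shift]
  · simp [totDiff_succ, shift]
  · simp [totDiff_succ, shift, totDiff_zero, vert]
  · rw [totDiff_succ]
    simp only [shift, LinearMap.pi_apply, LinearMap.proj_apply]
    rw [totDiff_succ]
    simp [vert, horiz, Nat.even_add_one]

end

/-! ### Comparison of the cyclic coinvariants with the total complex -/

section

variable {C : Type*} [AddCommGroup C] [Module ℂ C]

/-- A set of bidegrees stable under the differentials. -/
def StepStable (S : Set (ℕ × ℕ)) : Prop := ∀ p ∈ S, bidegStep p ⊆ S

theorem atDeg_pos {S : Set (ℕ × ℕ)} {k : ℤ} : ∀ p ∈ atDeg S k, 0 < p.1 + p.2 := fun _ hp => hp.2.1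

theorem StepStable.atDeg {S : Set (ℕ × ℕ)} (hS : StepStable S) {k : ℤ} :
    ∀ p ∈ atDeg S k, bidegStep p ⊆ atDeg S (k + 1) := by
  rintro p ⟨hp, h0, hk⟩ q hq
  refine ⟨hS p hp hq, ?_⟩
  rcases hq with ⟨h1, h2⟩ | ⟨h1, h2⟩ <;> constructor <;> omega

/-- Non-empty words have positive degree, so only finitely many columns matter in each total degree.
-/
theorem wordSpan_atDeg_eq_bot (S : Set (ℕ × ℕ)) {k : ℤ} (hk : k ≤ 0) :
    (wordSpan (atDeg S k) : Submodule ℂ (T C)) = ⊥ := by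
  rw [← wordSpan_empty]
  congr
  ext p
  simp only [atDeg, Set.mem_inter_iff, Set.mem_ofPred_eq, Set.mem_empty_iff_false, iff_false]
  omega

theorem single_mem_tot {A : ℤ → Submodule ℂ (T C)} {m : ℤ} {p : ℕ} {x : T C} (hx : x ∈ A (m - p)) :
    (Pi.single p x : ℕ → T C) ∈ tot C A m := by
  rw [mem_tot]
  intro q
  by_cases h : q = p
  · subst h; simpa using hx
  · simp [h]

theorem horiz_mem {S : Set (ℕ × ℕ)} {x : T C} (hx : x ∈ wordSpan S) (p : ℕ) :
    horiz C p x ∈ wordSpan S := by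
  unfold horiz
  split_ifs
  · exact sub_mem (cyc_mem hx) hx
  · exact cycNorm_mem hx

theorem exact_horiz {S R : Set (ℕ × ℕ)} (hS : ∀ p ∈ S, 0 < p.1 + p.2) (p : ℕ) {x : T C}
    (hx : x ∈ wordSpan S) (h : horiz C (p + 1) x ∈ wordSpan R) :
    ∃ y ∈ wordSpan S, x - horiz C p y ∈ wordSpan R := by
  by_cases hp : Even p
  · simp only [horiz, hp, Nat.even_add_one, not_true_eq_false, if_true, if_false] at h ⊢
    exact exact_cycNorm hS hx h
  · simp only [horiz, hp, Nat.even_add_one, not_false_eq_true, if_true, if_false] at h ⊢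
    exact exact_cyc hS hx h

section Stable

variable {S R : Set (ℕ × ℕ)} {k : ℤ}

variable (C) in
/-- The graded subspace spanned by the words with bidegree in `S`. -/
abbrev grWords (S : Set (ℕ × ℕ)) (k : ℤ) : Submodule ℂ (T C) := wordSpan (atDeg S k)

theorem augment_mem_tot {m : ℤ} {x : T C} (hx : cycNorm C x ∈ grWords C S m) :
    augment C x ∈ tot C (grWords C S) m :=
  single_mem_tot (by simpa using hx)

variable (C) in
/-- The kernel of the projection to the cyclic coinvariants of a quotient. -/
def grCyc (S R : Set (ℕ × ℕ)) (k : ℤ) : Submodule ℂ (T C) :=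
  grWords C R k ⊔ cycComm (atDeg S k)

theorem mem_grCyc {x : T C} :
    x ∈ grCyc C S R k ↔ ∃ y ∈ grWords C S k, x - (cyc C y - y) ∈ grWords C R k := by
  rw [grCyc, Submodule.mem_sup]
  constructor
  · rintro ⟨b, hb, _, ⟨y, hy, rfl⟩, rfl⟩
    exact ⟨y, hy, by simpa using hb⟩
  · rintro ⟨y, hy, h⟩
    exact ⟨_, h, _, ⟨y, hy, rfl⟩, by simp⟩

theorem cycNorm_mem_of_mem_grCyc {x : T C} (hx : x ∈ grCyc C S R k) :
    cycNorm C x ∈ grWords C R k := by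
  obtain ⟨y, -, h⟩ := mem_grCyc.1 hx
  have := cycNorm_mem h
  rwa [map_sub, map_sub, cycNorm_cyc, sub_self, sub_zero] at this

variable [Coalgebra ℂ C]

theorem diff_mem_atDeg (hS : StepStable S) {x : T C} (hx : x ∈ wordSpan (atDeg S k)) :
    diff C x ∈ wordSpan (atDeg S (k + 1)) := map_mem_wordSpan diff_word_mem hS.atDeg hx

theorem diffB_mem_atDeg (hS : StepStable S) {x : T C} (hx : x ∈ wordSpan (atDeg S k)) :
    diffB C x ∈ wordSpan (atDeg S (k + 1)) := map_mem_wordSpan diffB_word_mem hS.atDeg hx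

theorem vert_mem_atDeg (hS : StepStable S) {x : T C} (hx : x ∈ wordSpan (atDeg S k)) (p : ℕ) :
    vert C p x ∈ wordSpan (atDeg S (k + 1)) := by
  unfold vert
  split_ifs
  · exact diffB_mem_atDeg hS hx
  · exact neg_mem (diff_mem_atDeg hS hx)

theorem totDiff_mem_tot (hS : StepStable S) {x : ℕ → T C}
    (hx : x ∈ tot C (fun k => wordSpan (atDeg S k)) k) :
    totDiff C x ∈ tot C (fun k => wordSpan (atDeg S k)) (k + 1) := by
  rw [mem_tot] at hx ⊢
  rintro (- | p)
  · rw [totDiff_zero]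
    simpa using diffB_mem_atDeg hS (hx 0)
  · rw [totDiff_succ]
    refine add_mem ?_ ?_
    · have := vert_mem_atDeg hS (hx (p + 1)) (p + 1)
      rwa [sub_add_eq_add_sub] at this
    · have := horiz_mem (hx p) p
      rwa [show k + 1 - ((p + 1 : ℕ) : ℤ) = k - p by push_cast; ring]

/-- A family of the total complex whose differential is zero modulo `R` outside of column `0` is,
modulo `R` and boundaries, concentrated in column `0`. -/
theorem exists_reduce_column (hS : StepStable S) (hR : StepStable R) {m : ℤ} (n : ℕ)
    {y : ℕ → T C} (hy : y ∈ tot C (grWords C S) m)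
    (hD : ∀ p : ℕ, totDiff C y (p + 1) ∈ grWords C R (m - p))
    (hn : ∀ p : ℕ, n < p → y p ∈ grWords C R (m - p)) :
    ∃ z ∈ tot C (grWords C S) (m - 1),
      ∀ p : ℕ, 0 < p → (y - totDiff C z) p ∈ grWords C R (m - p) := by
  induction n generalizing y with
  | zero => exact ⟨0, zero_mem _, fun p hp => by simpa using hn p hp⟩
  | succ n ih =>
    -- In column `n + 2` the vertical term is already in `R`, hence so is the horizontal one.
    have h1 : horiz C (n + 1) (y (n + 1)) ∈ grWords C R (m - (n + 1 : ℕ)) := by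
      have h2 := vert_mem_atDeg hR (hn (n + 2) (by omega)) (n + 2)
      rw [show m - ((n + 2 : ℕ) : ℤ) + 1 = m - (n + 1 : ℕ) by push_cast; ring] at h2
      have h3 := hD (n + 1)
      rw [totDiff_succ] at h3
      simpa using sub_mem h3 h2
    -- Subtracting the differential of `u`, placed in column `n`, clears column `n + 1` and
    -- otherwise changes only column `n`.
    obtain ⟨u, hu, hyu⟩ := exact_horiz atDeg_pos n (mem_tot.1 hy (n + 1)) h1
    have hw : (Pi.single n u : ℕ → T C) ∈ tot C (grWords C S) (m - 1) :=
      single_mem_tot (by rwa [show m - 1 - n = m - (n + 1 : ℕ) by push_cast; ring])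
    obtain ⟨z, hz, h⟩ := ih (y := y - totDiff C (Pi.single n u))
      (sub_mem hy (by simpa using totDiff_mem_tot hS hw))
      (fun p => by rw [map_sub, totDiff_totDiff, sub_zero]; exact hD p)
      (fun p hp => by
        obtain ⟨q, rfl⟩ : ∃ q, p = q + 1 := ⟨p - 1, by omega⟩
        rw [Pi.sub_apply, totDiff_succ, Pi.single_eq_of_ne (by omega), map_zero, zero_add]
        rcases eq_or_ne q n with rfl | hq
        · simpa using hyu
        · rw [Pi.single_eq_of_ne hq, map_zero, sub_zero]
          exact hn _ (by omega))
    refine ⟨Pi.single n u + z, add_mem hw hz, fun p hp => ?_⟩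
    rw [map_add, ← sub_sub]
    exact h p hp

/-- A family of the total complex whose differential is zero modulo `R` outside of column `0`
comes, modulo `R` and boundaries, from the augmentation. -/
theorem exists_sub_augment_mem (hS : StepStable S) (hR : StepStable R) {m : ℤ}
    {y : ℕ → T C} (hy : y ∈ tot C (grWords C S) m)
    (hD : ∀ p : ℕ, totDiff C y (p + 1) ∈ grWords C R (m - p)) :
    ∃ z ∈ tot C (grWords C S) (m - 1), ∃ u ∈ grWords C S m,
      y - totDiff C z - augment C u ∈ tot C (grWords C R) m := by
  obtain ⟨z, hz, h⟩ := exists_reduce_column hS hR m.toNat hy hD fun p hp => by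
    have := mem_tot.1 hy p
    rw [grWords, wordSpan_atDeg_eq_bot S (by omega), Submodule.mem_bot] at this
    rw [this]
    exact zero_mem _
  have hy' : y - totDiff C z ∈ tot C (grWords C S) m :=
    sub_mem hy (by simpa using totDiff_mem_tot hS hz)
  -- With column `1` in `R`, the entry in column `0` is `t`-invariant modulo `R`, hence a norm
  -- there.
  have h1 : horiz C 0 ((y - totDiff C z) 0) ∈ grWords C R m := by
    have h2 := vert_mem_atDeg hR (h 1 one_pos) 1
    have h3 := hD 0
    rw [← sub_zero (totDiff C y), ← totDiff_totDiff z, ← map_sub, totDiff_succ] at h3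
    simp only [Nat.cast_one, sub_add_cancel, Nat.cast_zero, sub_zero, zero_add] at h2 h3
    simpa only [add_sub_cancel_left] using sub_mem h3 h2
  have h0 := mem_tot.1 hy' 0
  rw [Nat.cast_zero, sub_zero] at h0
  obtain ⟨u, hu, hyu⟩ := exact_cyc atDeg_pos h0 (by simpa [horiz] using h1)
  refine ⟨z, hz, u, hu, mem_tot.2 ?_⟩
  rintro (- | p)
  · rw [Pi.sub_apply, augment_zero, Nat.cast_zero, sub_zero]
    exact hyu
  · rw [Pi.sub_apply, augment_succ, sub_zero]
    exact h _ p.succ_pos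

/-- The norm induces an isomorphism from the cohomology of the cyclic coinvariants to the cohomology
of the total complex of the cyclic bicomplex. -/
theorem exists_augment_equiv (hS : StepStable S) (hR : StepStable R) (l : ℤ) :
    ∃ ν : Coh (diff C) (grWords C S) (grCyc C S R) l ≃ₗ[ℂ]
        Coh (totDiff C) (tot C (grWords C S)) (tot C (grWords C R)) l,
      Induces (diff C) (grWords C S) (grCyc C S R) l
        (totDiff C) (tot C (grWords C S)) (tot C (grWords C R)) l (augment C) ν.toLinearMap := by
  apply exists_equiv_induces
  · intro x hx
    refine mem_cocycles.2 ⟨augment_mem_tot (cycNorm_mem hx.1), ?_⟩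
    rw [totDiff_augment]
    exact augment_mem_tot (cycNorm_mem_of_mem_grCyc hx.2)
  · intro x _ hx
    obtain ⟨y, hy, h⟩ := mem_coboundaries.1 hx
    refine mem_coboundaries.2 ⟨_, augment_mem_tot (cycNorm_mem hy), ?_⟩
    rw [totDiff_augment, ← map_sub]
    exact augment_mem_tot (cycNorm_mem_of_mem_grCyc h)
  · intro x hx hx'
    obtain ⟨y, hy, h⟩ := mem_coboundaries.1 hx'
    -- Injectivity: the family `y` bounding `N x` is `D z + N u` modulo `R`. So `N (x - ∂ u)` lies
    -- in `R`, and exactness of the row puts `x - ∂ u` in the image of `t - 1` modulo `R`.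
    obtain ⟨z, hz, u, hu, h'⟩ := exists_sub_augment_mem hS hR hy fun p => by
      have := neg_mem (mem_tot.1 h (p + 1))
      rw [Pi.sub_apply, augment_succ, zero_sub, neg_neg] at this
      rwa [show l - 1 - (p : ℤ) = l - (p + 1 : ℕ) by push_cast; ring]
    refine mem_coboundaries.2 ⟨u, hu, mem_grCyc.2 (exact_cycNorm atDeg_pos
      (sub_mem hx.1 (by simpa using diff_mem_atDeg hS hu)) ?_)⟩
    have h2 := totDiff_mem_tot hR h'
    rw [sub_add_cancel, map_sub, map_sub, totDiff_totDiff, sub_zero, totDiff_augment] at h2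
    have h3 := mem_tot.1 (add_mem h h2) 0
    rw [sub_add_sub_cancel, ← map_sub, augment_zero, Nat.cast_zero, sub_zero] at h3
    exact h3
  · intro y hy
    obtain ⟨z, hz, u, hu, h'⟩ := exists_sub_augment_mem hS hR hy.1 fun p => by
      have := mem_tot.1 hy.2 (p + 1)
      rwa [show l + 1 - ((p + 1 : ℕ) : ℤ) = l - p by push_cast; ring] at this
    refine ⟨u, ⟨hu, mem_grCyc.2 (exact_cycNorm atDeg_pos (diff_mem_atDeg hS hu) ?_)⟩,
      mem_coboundaries.2 ⟨-z, neg_mem hz, ?_⟩⟩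
    · have h2 := totDiff_mem_tot hR h'
      rw [map_sub, map_sub, totDiff_totDiff, sub_zero, totDiff_augment] at h2
      have h3 := mem_tot.1 (sub_mem hy.2 h2) 0
      rw [sub_sub_cancel, augment_zero, Nat.cast_zero, sub_zero] at h3
      exact h3
    · convert neg_mem h' using 1
      rw [map_neg]
      abel

/-- The shift of the cyclic bicomplex by two columns induces a map in cohomology. -/
theorem exists_shift_induces (k : ℤ) :
    ∃ σ : Coh (totDiff C) (tot C (grWords C S)) (tot C (grWords C R)) k →ₗ[ℂ]
        Coh (totDiff C) (tot C (grWords C S)) (tot C (grWords C R)) (k + 2),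
      Induces (totDiff C) (tot C (grWords C S)) (tot C (grWords C R)) k
        (totDiff C) (tot C (grWords C S)) (tot C (grWords C R)) (k + 2) (shift C) σ := by
  apply exists_induces
  · intro x hx
    refine mem_cocycles.2 ⟨shift_mem_tot hx.1, ?_⟩
    rw [totDiff_shift, add_right_comm]
    exact shift_mem_tot hx.2
  · intro x _ hx
    obtain ⟨y, hy, h⟩ := mem_coboundaries.1 hx
    refine mem_coboundaries.2 ⟨shift C y, ?_, ?_⟩
    · rw [add_sub_right_comm]
      exact shift_mem_tot hy
    · rw [totDiff_shift, ← map_sub]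
      exact shift_mem_tot h

end Stable

end

section

variable {C : Type*} [AddCommGroup C] [Module ℂ C]

/-! ### Forms on the line -/

@[simp] theorem coeff_coeffMap (f : T C →ₗ[ℂ] T C) (p : Polynomial (T C)) (n : ℕ) :
    (coeffMap C f p).coeff n = f (p.coeff n) := by
  induction p using Polynomial.induction_on' with
  | add p q hp hq => simp [hp, hq]
  | monomial m a =>
    simp [coeffMap, Polynomial.coeff_monomial, apply_ite f]

theorem coeffMap_parity_mul (p q : Polynomial (T C)) :
    coeffMap C (parity C).toLinearMap (p * q) =
      coeffMap C (parity C).toLinearMap p * coeffMap C (parity C).toLinearMap q := by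
  ext n
  simp [Polynomial.coeff_mul]

theorem form_apply (p q : Polynomial (T C)) :
    form C (p, q) = !![p, q; 0, coeffMap C (parity C).toLinearMap p] := rfl

@[simp] theorem coeffs_form (a : Polynomial (T C) × Polynomial (T C)) :
    coeffs C (form C a) = a := rfl

theorem form_mul (p q r s : Polynomial (T C)) : form C (p, q) * form C (r, s) =
    form C (p * r, p * s + q * coeffMap C (parity C).toLinearMap r) := by
  simp [form_apply, coeffMap_parity_mul]

theorem form_one : form C (1, 0) = 1 := by
  have : coeffMap C (parity C).toLinearMap 1 = 1 := by
    ext n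
    simp [Polynomial.coeff_one, apply_ite (parity C)]
  rw [form_apply, this, Matrix.one_fin_two]

@[simp] theorem coeffMap_monomial (f : T C →ₗ[ℂ] T C) (n : ℕ) (x : T C) :
    coeffMap C f (Polynomial.monomial n x) = Polynomial.monomial n (f x) := by
  simp [coeffMap]

variable (C) in
/-- The map `x t^j ↦ (-1)^{|x|} x / (j + 1)`. -/
def integral : Polynomial (T C) →ₗ[ℂ] T C :=
  Polynomial.lsum fun j => ((j : ℂ) + 1)⁻¹ • (parity C).toLinearMap

theorem formInt_form (p q : Polynomial (T C)) : formInt C (form C (p, q)) = integral C q := rfl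

theorem integral_monomial (n : ℕ) (x : T C) :
    integral C (Polynomial.monomial n x) = ((n : ℂ) + 1)⁻¹ • parity C x := by
  simp [integral]

theorem integral_mem {P : Submodule ℂ (T C)} (hP : ∀ x ∈ P, parity C x ∈ P)
    {p : Polynomial (T C)} (hp : ∀ n, p.coeff n ∈ P) : integral C p ∈ P := by
  rw [← p.sum_monomial_eq, Polynomial.sum, map_sum]
  refine sum_mem fun n _ => ?_
  rw [integral_monomial]
  exact P.smul_mem _ (hP _ (hp n))

theorem coeff_mul_mem {P Q R : Submodule ℂ (T C)} (h : ∀ x ∈ P, ∀ y ∈ Q, x * y ∈ R)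
    {p q : Polynomial (T C)} (hp : ∀ n, p.coeff n ∈ P) (hq : ∀ n, q.coeff n ∈ Q) (n : ℕ) :
    (p * q).coeff n ∈ R := by
  rw [Polynomial.coeff_mul]
  exact sum_mem fun i _ => h _ (hp _) _ (hq _)

variable (C) in
/-- Evaluation of polynomials at `1`. -/
def evalOne : Polynomial (T C) →+* T C :=
  Polynomial.eval₂RingHom' (RingHom.id _) 1 fun _ => Commute.one_right _

theorem evalOne_monomial (n : ℕ) (x : T C) : evalOne C (Polynomial.monomial n x) = x := by
  simp [evalOne]

/-- The fundamental theorem of calculus; the sign `(-1)^{|x|}` in `D` cancels the one in the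
integral. -/
theorem integral_derivative (p : Polynomial (T C)) :
    integral C (Polynomial.derivative (coeffMap C (parity C).toLinearMap p)) =
      evalOne C p - p.coeff 0 := by
  induction p using Polynomial.induction_on' with
  | add p q hp hq => simp only [map_add, hp, hq, Polynomial.coeff_add]; abel
  | monomial n x =>
    rw [coeffMap_monomial, Polynomial.derivative_monomial, integral_monomial, evalOne_monomial]
    rcases n with - | n
    · simp
    · have h : (n : ℂ) + 1 ≠ 0 := by exact_mod_cast n.succ_ne_zero
      rw [← nsmul_eq_mul', map_nsmul, Nat.add_sub_cancel, ← Nat.cast_smul_eq_nsmul ℂ, smul_smul]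
      simp [h]

theorem path_apply (h : C) : path C h = form C (Polynomial.monomial 1 (gen C h), 0) := rfl

variable [Coalgebra ℂ C]

theorem coeffMap_diff_mul (p q : Polynomial (T C)) :
    coeffMap C (diff C) (p * q) = coeffMap C (diff C) p * q +
      coeffMap C (parity C).toLinearMap p * coeffMap C (diff C) q := by
  ext n
  simp [Polynomial.coeff_mul, diff_mul, Finset.sum_add_distrib]

theorem coeffMap_diff_parity (p : Polynomial (T C)) :
    coeffMap C (diff C) (coeffMap C (parity C).toLinearMap p) =
      -coeffMap C (parity C).toLinearMap (coeffMap C (diff C) p) := by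
  ext n
  simp [diff_parity]

theorem coeffMap_diff_diff (p : Polynomial (T C)) :
    coeffMap C (diff C) (coeffMap C (diff C) p) = 0 := by
  ext n
  simp [diff_diff]

theorem coeffMap_diff_derivative (p : Polynomial (T C)) :
    coeffMap C (diff C) (Polynomial.derivative p) =
      Polynomial.derivative (coeffMap C (diff C) p) := by
  ext n
  simp only [coeff_coeffMap, Polynomial.coeff_derivative]
  rw [← Nat.cast_succ, ← nsmul_eq_mul', map_nsmul, nsmul_eq_mul']

theorem formDiff_form (p q : Polynomial (T C)) : formDiff C (form C (p, q)) =
    form C (coeffMap C (diff C) p, Polynomial.derivative (coeffMap C (parity C).toLinearMap p) +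
      coeffMap C (diff C) q) := rfl

/-- The sign in front of the second term is the parity automorphism of forms, for which `dt` is odd.
-/
theorem formDiff_form_mul (p q r s : Polynomial (T C)) :
    formDiff C (form C (p, q) * form C (r, s)) =
      formDiff C (form C (p, q)) * form C (r, s) +
        form C (coeffMap C (parity C).toLinearMap p, -coeffMap C (parity C).toLinearMap q) *
          formDiff C (form C (r, s)) := by
  simp only [form_mul, formDiff_form, ← (form C).map_add, Prod.mk_add_mk]
  refine congrArg (form C) (Prod.ext (coeffMap_diff_mul _ _) ?_)
  have aux {R : Type _} [Ring R] (x r' p' y dp s ds dq q' f : R) :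
      x * r' + p' * y + (dp * s + p' * ds + (dq * r' + q' * -f)) =
        dp * s + (x + dq) * r' + (p' * (y + ds) + -q' * f) := by noncomm_ring
  dsimp only
  rw [map_add, coeffMap_diff_mul p s, coeffMap_diff_mul q, coeffMap_parity_mul,
    Polynomial.derivative_mul, coeffMap_diff_parity]
  exact aux _ _ _ _ _ _ _ _ _ _

theorem formDiff_formDiff (p q : Polynomial (T C)) :
    formDiff C (formDiff C (form C (p, q))) = 0 := by
  simp only [formDiff_form, map_add, coeffMap_diff_derivative, coeffMap_diff_parity,
    coeffMap_diff_diff]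
  simp [← Prod.zero_eq_mk]

theorem integral_diff (p : Polynomial (T C)) :
    integral C (coeffMap C (diff C) p) = -diff C (integral C p) := by
  induction p using Polynomial.induction_on' with
  | add p q hp hq => simp only [map_add, hp, hq, neg_add]
  | monomial n x =>
    rw [coeffMap_monomial, integral_monomial, integral_monomial, map_smul, diff_parity, smul_neg,
      neg_neg]

/-- Stokes' formula on the interval: the terms with `∂` cancel because the integral anticommutes
with `∂`, and the endpoint values remain. -/
theorem formInt_formDiff (p q : Polynomial (T C)) :
    formInt C (formDiff C (form C (p, q))) + diff C (formInt C (form C (p, q))) =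
      evalOne C p - p.coeff 0 := by
  rw [formDiff_form, formInt_form, formInt_form, map_add, integral_derivative, integral_diff]
  abel

/-! ### The characteristic map of the path -/

variable (C) in
/-- The characteristic map of `h ↦ h ⊗ t`. -/
abbrev pathMap : T C →ₐ[ℂ] Forms C := charMap (formDiff C) (path C)

theorem pathMap_gen (h : C) : pathMap C (gen C h) = path C h := by
  simp [pathMap, charMap]

theorem pathMap_curv (h : C) :
    pathMap C (curv C h) = formDiff C (path C h) + conv (path C) (path C) h := by
  simp [pathMap, charMap, curvature]

theorem conv_path (h : C) : conv (path C) (path C) h =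
    form C (Polynomial.monomial 2 (conv (gen C) (gen C) h), 0) := by
  have : (⟨Polynomial.monomial 2 (conv (gen C) (gen C) h), 0⟩ :
      Polynomial (T C) × Polynomial (T C)) =
      LinearMap.inl ℂ _ _ ((Polynomial.monomial 2).restrictScalars ℂ (conv (gen C) (gen C) h)) :=
    rfl
  rw [this, conv_eq_sum, conv_eq_sum, map_sum, map_sum, map_sum]
  refine Finset.sum_congr rfl fun i _ => ?_
  rw [path_apply, path_apply, form_mul, Polynomial.monomial_mul_monomial, mul_zero, zero_mul,
    add_zero]
  rfl

/-- The function part interpolates between `0` and `∂h + ∑ h_0 h_1 = ω_h`, which makes `H` a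
contraction. -/
theorem pathMap_curv_eq_form (h : C) : pathMap C (curv C h) =
    form C (Polynomial.monomial 1 (diff C (gen C h)) +
      Polynomial.monomial 2 (conv (gen C) (gen C) h), -Polynomial.monomial 0 (gen C h)) := by
  rw [pathMap_curv, conv_path, path_apply, formDiff_form, ← map_add, Prod.mk_add_mk]
  simp

variable (C) in
/-- The coefficient of `1` of the characteristic map of the path. -/
def pathMap₀ : T C →ₗ[ℂ] Polynomial (T C) :=
  LinearMap.fst ℂ _ _ ∘ₗ coeffs C ∘ₗ (pathMap C).toLinearMap

variable (C) in
/-- The coefficient of `dt` of the characteristic map of the path. -/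
def pathMap₁ : T C →ₗ[ℂ] Polynomial (T C) :=
  LinearMap.snd ℂ _ _ ∘ₗ coeffs C ∘ₗ (pathMap C).toLinearMap

theorem contraction_apply (x : T C) : contraction C x = integral C (pathMap₁ C x) := rfl

/-- `Forms` contains matrices that are not forms. Those in the range of `form` are closed under
products and contain the images of the generators, so `k` takes values there. -/
theorem pathMap_eq_form (x : T C) : pathMap C x = form C (pathMap₀ C x, pathMap₁ C x) := by
  suffices (pathMap C).toLinearMap = form C ∘ₗ (pathMap₀ C).prod (pathMap₁ C) from
    LinearMap.congr_fun this x
  have key (x y : T C) (a b) (hx : pathMap C x = form C a) (hy : pathMap C y = form C b) :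
      pathMap C (x * y) = form C (pathMap₀ C (x * y), pathMap₁ C (x * y)) := by
    have : pathMap C (x * y) = form C (a.1 * b.1,
        a.1 * b.2 + a.2 * coeffMap C (parity C).toLinearMap b.1) := by
      rw [map_mul, hx, hy, ← form_mul]
    conv_rhs => simp only [pathMap₀, pathMap₁, LinearMap.comp_apply, AlgHom.toLinearMap_apply, this]
    exact this
  apply ext_left
  · have : pathMap C 1 = form C (1, 0) := by rw [map_one, form_one]
    change pathMap C 1 = form C (coeffs C (pathMap C 1))
    rw [this, coeffs_form]
  · intro h x hx
    exact key _ _ _ _ ((pathMap_gen h).trans (path_apply h)) hx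
  · intro h x hx
    exact key _ _ _ _ (pathMap_curv_eq_form h) hx

theorem pathMap₀_mul (x y : T C) : pathMap₀ C (x * y) = pathMap₀ C x * pathMap₀ C y := by
  have := congrArg (coeffs C) (map_mul (pathMap C) x y)
  rw [pathMap_eq_form, pathMap_eq_form x, pathMap_eq_form y, form_mul] at this
  exact congrArg Prod.fst this

theorem pathMap₁_mul (x y : T C) : pathMap₁ C (x * y) = pathMap₀ C x * pathMap₁ C y +
    pathMap₁ C x * coeffMap C (parity C).toLinearMap (pathMap₀ C y) := by
  have := congrArg (coeffs C) (map_mul (pathMap C) x y)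
  rw [pathMap_eq_form, pathMap_eq_form x, pathMap_eq_form y, form_mul] at this
  exact congrArg Prod.snd this

theorem pathMap₀_one : pathMap₀ C 1 = 1 := by
  have := congrArg (coeffs C) ((map_one (pathMap C)).trans form_one.symm)
  rw [pathMap_eq_form] at this
  exact congrArg Prod.fst this

theorem pathMap₁_one : pathMap₁ C 1 = 0 := by
  have := congrArg (coeffs C) ((map_one (pathMap C)).trans form_one.symm)
  rw [pathMap_eq_form] at this
  exact congrArg Prod.snd this

theorem pathMap₀_gen (h : C) : pathMap₀ C (gen C h) = Polynomial.monomial 1 (gen C h) := by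
  have := congrArg (coeffs C) ((pathMap_gen h).trans (path_apply h))
  rw [pathMap_eq_form] at this
  exact congrArg Prod.fst this

theorem pathMap₁_gen (h : C) : pathMap₁ C (gen C h) = 0 := by
  have := congrArg (coeffs C) ((pathMap_gen h).trans (path_apply h))
  rw [pathMap_eq_form] at this
  exact congrArg Prod.snd this

theorem pathMap₀_curv (h : C) : pathMap₀ C (curv C h) =
    Polynomial.monomial 1 (diff C (gen C h)) + Polynomial.monomial 2 (conv (gen C) (gen C) h) := by
  have := congrArg (coeffs C) (pathMap_curv_eq_form h)
  rw [pathMap_eq_form] at this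
  exact congrArg Prod.fst this

theorem pathMap₁_curv (h : C) : pathMap₁ C (curv C h) = -Polynomial.monomial 0 (gen C h) := by
  have := congrArg (coeffs C) (pathMap_curv_eq_form h)
  rw [pathMap_eq_form] at this
  exact congrArg Prod.snd this

theorem formDiff_path_mul (h : C) (p q : Polynomial (T C)) :
    formDiff C (path C h * form C (p, q)) =
      formDiff C (path C h) * form C (p, q) - path C h * formDiff C (form C (p, q)) := by
  have : form C (coeffMap C (parity C).toLinearMap (Polynomial.monomial 1 (gen C h)),
      -coeffMap C (parity C).toLinearMap 0) = -form C (Polynomial.monomial 1 (gen C h), 0) := by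
    rw [← map_neg (form C), coeffMap_monomial, map_zero, AlgHom.toLinearMap_apply, parity_gen,
      map_neg, Prod.neg_mk]
  rw [path_apply, formDiff_form_mul, this, sub_eq_add_neg, ← Matrix.neg_mul]

theorem formDiff_pathMap_curv_mul (h : C) (p q : Polynomial (T C)) :
    formDiff C (pathMap C (curv C h) * form C (p, q)) =
      formDiff C (pathMap C (curv C h)) * form C (p, q) +
        pathMap C (curv C h) * formDiff C (form C (p, q)) := by
  rw [pathMap_curv_eq_form, formDiff_form_mul]
  have h1 : coeffMap C (parity C).toLinearMap (Polynomial.monomial 1 (diff C (gen C h)) +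
      Polynomial.monomial 2 (conv (gen C) (gen C) h)) = Polynomial.monomial 1 (diff C (gen C h)) +
      Polynomial.monomial 2 (conv (gen C) (gen C) h) := by
    simp [diff_gen, parity_conv_gen_gen]
  have h2 : -coeffMap C (parity C).toLinearMap (-Polynomial.monomial 0 (gen C h)) =
      -Polynomial.monomial 0 (gen C h) := by
    rw [map_neg, coeffMap_monomial, AlgHom.toLinearMap_apply, parity_gen, map_neg, neg_neg]
  rw [h1, h2]

theorem formDiff_one : formDiff C 1 = 0 := by
  rw [← form_one, formDiff_form]
  have h1 : coeffMap C (diff C) 1 = 0 := by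
    ext n
    simp [Polynomial.coeff_one, apply_ite (diff C)]
  have h2 : coeffMap C (parity C).toLinearMap 1 = 1 := by
    ext n
    simp [Polynomial.coeff_one, apply_ite (parity C)]
  rw [h1, h2, Polynomial.derivative_one, map_zero, add_zero, ← Prod.zero_eq_mk, map_zero]

theorem pathMap_conv (f g : C →ₗ[ℂ] T C) (h : C) : pathMap C (conv f g h) =
    conv ((pathMap C).toLinearMap ∘ₗ f) ((pathMap C).toLinearMap ∘ₗ g) h :=
  LinearMap.congr_fun (map_conv (pathMap C) f g) h

theorem pathMap_comp_gen : (pathMap C).toLinearMap ∘ₗ gen C = path C := LinearMap.ext pathMap_gen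

theorem pathMap_comp_curv : (pathMap C).toLinearMap ∘ₗ curv C =
    formDiff C ∘ₗ path C + conv (path C) (path C) := LinearMap.ext pathMap_curv

theorem pathMap_diff_gen (h : C) : pathMap C (diff C (gen C h)) = formDiff C (path C h) := by
  rw [diff_gen, map_sub, pathMap_conv, pathMap_comp_gen, pathMap_curv, add_sub_cancel_right]

theorem formDiff_conv_path : formDiff C ∘ₗ conv (path C) (path C) =
    conv (formDiff C ∘ₗ path C) (path C) - conv (path C) (formDiff C ∘ₗ path C) := by
  ext1 c
  rw [LinearMap.comp_apply, LinearMap.sub_apply, conv_eq_sum, conv_eq_sum, conv_eq_sum, map_sum,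
    ← Finset.sum_sub_distrib]
  exact Finset.sum_congr rfl fun i _ => formDiff_path_mul _ _ _

/-- The Bianchi identity for the curvature of the path: `D² = 0`, and the cubic terms cancel by
coassociativity. -/
theorem pathMap_diff_curv (h : C) :
    pathMap C (diff C (curv C h)) = formDiff C (pathMap C (curv C h)) := by
  rw [diff_curv, map_sub, pathMap_conv, pathMap_conv, pathMap_comp_gen, pathMap_comp_curv,
    pathMap_curv, map_add, path_apply, formDiff_formDiff, ← LinearMap.comp_apply,
    formDiff_conv_path, conv_add_left, conv_add_right, conv_assoc, LinearMap.add_apply,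
    LinearMap.add_apply, LinearMap.sub_apply, add_sub_add_right_eq_sub, zero_add]

/-- The characteristic map of the path commutes with the differentials. -/
theorem pathMap_diff (x : T C) : pathMap C (diff C x) = formDiff C (pathMap C x) := by
  suffices (pathMap C).toLinearMap ∘ₗ diff C = formDiff C ∘ₗ (pathMap C).toLinearMap from
    LinearMap.congr_fun this x
  apply ext_left
  · rw [LinearMap.comp_apply, LinearMap.comp_apply, AlgHom.toLinearMap_apply,
      AlgHom.toLinearMap_apply, diff_one, map_zero, map_one, formDiff_one]
  · intro h x hx
    rw [LinearMap.comp_apply, LinearMap.comp_apply, AlgHom.toLinearMap_apply,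
      AlgHom.toLinearMap_apply] at hx ⊢
    rw [diff_mul, map_add, map_mul, map_mul, hx, parity_gen, map_neg, map_mul, pathMap_gen,
      pathMap_eq_form x, formDiff_path_mul, pathMap_diff_gen, Matrix.neg_mul, sub_eq_add_neg]
  · intro h x hx
    rw [LinearMap.comp_apply, LinearMap.comp_apply, AlgHom.toLinearMap_apply,
      AlgHom.toLinearMap_apply] at hx ⊢
    rw [diff_mul, map_add, map_mul, map_mul, hx, parity_curv, map_mul,
      pathMap_eq_form x, formDiff_pathMap_curv_mul, pathMap_diff_curv]

theorem evalOne_pathMap₀_word (l : List (C ⊕ C)) :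
    evalOne C (pathMap₀ C (word C l)) = word C l := by
  induction l with
  | nil => rw [word_nil, pathMap₀_one, map_one]
  | cons a l ih =>
    rw [word_cons, pathMap₀_mul, map_mul, ih]
    rcases a with h | h
    · rw [letter, Sum.elim_inl, pathMap₀_gen, evalOne_monomial]
    · rw [letter, Sum.elim_inr, pathMap₀_curv, map_add, evalOne_monomial, evalOne_monomial,
        diff_gen, sub_add_cancel]

theorem coeff_zero_pathMap₀_word (l : List (C ⊕ C)) (hl : l ≠ []) :
    (pathMap₀ C (word C l)).coeff 0 = 0 := by
  rcases l with - | ⟨a, l⟩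
  · exact absurd rfl hl
  rw [word_cons, pathMap₀_mul, Polynomial.mul_coeff_zero]
  rcases a with h | h
  · rw [letter, Sum.elim_inl, pathMap₀_gen, Polynomial.coeff_monomial]
    simp
  · rw [letter, Sum.elim_inr, pathMap₀_curv, Polynomial.coeff_add, Polynomial.coeff_monomial,
      Polynomial.coeff_monomial]
    simp

/-- The Weil algebra is contractible. -/
theorem contraction_diff_add {S : Set (ℕ × ℕ)} (hS : ∀ p ∈ S, 0 < p.1 + p.2) {x : T C}
    (hx : x ∈ wordSpan S) : contraction C (diff C x) + diff C (contraction C x) = x := by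
  refine eqOn_wordSpan (f := contraction C ∘ₗ diff C + diff C ∘ₗ contraction C)
    (g := LinearMap.id) (fun l hl => ?_) hx
  -- `k` commutes with the differentials, so Stokes becomes the homotopy formula. Its endpoint terms
  -- are the word itself at `1` and zero at `0`, the word being non-empty.
  have h := formInt_formDiff (pathMap₀ C (word C l)) (pathMap₁ C (word C l))
  rw [← pathMap_eq_form, ← pathMap_diff, evalOne_pathMap₀_word,
    coeff_zero_pathMap₀_word l ((ne_nil_iff_bideg l).2 (hS _ hl)), sub_zero] at h
  exact h

end

/-! ### Degrees and commutators under the contraction -/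

section

theorem wordDeg_cons {C : Type*} (a : C ⊕ C) (l : List (C ⊕ C)) :
    wordDeg C [a] + wordDeg C l = wordDeg C (a :: l) := (wordDeg_append [a] l).symm

variable {C : Type*} [AddCommGroup C] [Module ℂ C]

theorem parity_of_mem {S : Set (ℕ × ℕ)} {k : ℤ} {x : T C} (hx : x ∈ grWords C S k) :
    parity C x = sgn k • x := by
  refine eqOn_wordSpan (f := (parity C).toLinearMap) (g := sgn k • LinearMap.id)
    (fun l hl => ?_) hx
  rw [AlgHom.toLinearMap_apply, parity_word, wordDeg_eq_bideg, hl.2.2]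
  rfl

theorem coeffMap_parity_of_mem {S : Set (ℕ × ℕ)} {k : ℤ} {p : Polynomial (T C)}
    (hp : ∀ n, p.coeff n ∈ grWords C S k) : coeffMap C (parity C).toLinearMap p = sgn k • p := by
  ext n
  rw [coeff_coeffMap, AlgHom.toLinearMap_apply, parity_of_mem (hp n), Polynomial.coeff_smul]

theorem parity_mem_cycComm {S : Set (ℕ × ℕ)} {x : T C} (hx : x ∈ cycComm S) :
    parity C x ∈ cycComm S := by
  obtain ⟨y, hy, rfl⟩ := mem_cycComm.1 hx
  exact mem_cycComm.2 ⟨_, parity_mem hy, by rw [cyc_parity, map_sub]⟩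

theorem comm_mem_cycComm {i j : ℤ} {x y : T C} (hx : x ∈ grWords C Set.univ i)
    (hy : y ∈ grWords C Set.univ j) :
    x * y - sgn (i * j) • (y * x) ∈ cycComm {p | 0 < p.1 + p.2} := by
  rw [← gradedComm_weil]
  refine Submodule.subset_span ⟨i, j, x, ?_, y, ?_, rfl⟩ <;> rw [weil_eq, gr_wordSpan] <;>
    refine wordSpan_mono ?_ ‹_› <;> exact fun p hp => ⟨hp.2.1, hp.2⟩

theorem coeff_comm_mem_cycComm {i j : ℤ} {p q : Polynomial (T C)}
    (hp : ∀ n, p.coeff n ∈ grWords C Set.univ i) (hq : ∀ n, q.coeff n ∈ grWords C Set.univ j)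
    (n : ℕ) : (p * q - sgn (i * j) • (q * p)).coeff n ∈ cycComm {p | 0 < p.1 + p.2} := by
  rw [Polynomial.coeff_sub, Polynomial.coeff_smul, Polynomial.coeff_mul, Polynomial.coeff_mul,
    ← Finset.Nat.sum_antidiagonal_swap (f := fun a => q.coeff a.1 * p.coeff a.2), Finset.smul_sum,
    ← Finset.sum_sub_distrib]
  exact sum_mem fun a _ => comm_mem_cycComm (hp _) (hq _)

variable (C) in
/-- The span of the words, possibly empty, of total degree `k`. -/
abbrev degWords (k : ℤ) : Submodule ℂ (T C) := wordSpan {p | (p.1 : ℤ) + 2 * p.2 = k}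

theorem mul_mem_degWords {i j k : ℤ} (h : i + j = k) {x y : T C} (hx : x ∈ degWords C i)
    (hy : y ∈ degWords C j) : x * y ∈ degWords C k := by
  refine mul_mem_wordSpan (fun p hp q hq => ?_) hx hy
  simp only [Set.mem_ofPred_eq, Prod.fst_add, Prod.snd_add] at hp hq ⊢
  omega

theorem mul_mem_grWords_left {i j k : ℤ} (h : i + j = k) {x y : T C}
    (hx : x ∈ grWords C Set.univ i) (hy : y ∈ degWords C j) : x * y ∈ grWords C Set.univ k := by
  refine mul_mem_wordSpan (fun p hp q hq => ?_) hx hy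
  simp only [atDeg, Set.univ_inter, Set.mem_ofPred_eq, Prod.fst_add, Prod.snd_add] at hp hq ⊢
  omega

theorem mul_mem_grWords_right {i j k : ℤ} (h : i + j = k) {x y : T C}
    (hx : x ∈ degWords C i) (hy : y ∈ grWords C Set.univ j) : x * y ∈ grWords C Set.univ k := by
  refine mul_mem_wordSpan (fun p hp q hq => ?_) hx hy
  simp only [atDeg, Set.univ_inter, Set.mem_ofPred_eq, Prod.fst_add, Prod.snd_add] at hp hq ⊢
  omega

theorem grWords_le_degWords (k : ℤ) : grWords C Set.univ k ≤ degWords C k :=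
  wordSpan_mono fun _ hp => hp.2.2

theorem coeff_monomial_mem {P : Submodule ℂ (T C)} {x : T C} (hx : x ∈ P) (m n : ℕ) :
    (Polynomial.monomial m x).coeff n ∈ P := by
  rw [Polynomial.coeff_monomial]
  split_ifs
  · exact hx
  · exact zero_mem _

theorem gen_mem_grWords (h : C) : gen C h ∈ grWords C Set.univ 1 :=
  wordSpan_mono (by rintro _ rfl; simp [atDeg]) (gen_mem h)

theorem curv_mem_grWords (h : C) : curv C h ∈ grWords C Set.univ 2 :=
  wordSpan_mono (by rintro _ rfl; simp [atDeg]) (curv_mem h)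

variable [Coalgebra ℂ C]

theorem conv_gen_mem_grWords (h : C) : conv (gen C) (gen C) h ∈ grWords C Set.univ 2 :=
  wordSpan_mono (by rintro _ rfl; simp [atDeg]) (conv_mem gen_mem gen_mem rfl h)

theorem pathMap₀_letter_mem (a : C ⊕ C) (n : ℕ) :
    (pathMap₀ C (letter a)).coeff n ∈ grWords C Set.univ (wordDeg C [a]) := by
  rcases a with h | h
  · rw [letter, Sum.elim_inl, pathMap₀_gen]
    exact coeff_monomial_mem (gen_mem_grWords h) _ _
  · rw [letter, Sum.elim_inr, pathMap₀_curv, Polynomial.coeff_add, diff_gen]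
    exact add_mem (coeff_monomial_mem (sub_mem (curv_mem_grWords h) (conv_gen_mem_grWords h)) _ _)
      (coeff_monomial_mem (conv_gen_mem_grWords h) _ _)

theorem pathMap₁_letter_mem (a : C ⊕ C) (n : ℕ) :
    (pathMap₁ C (letter a)).coeff n ∈ grWords C Set.univ (wordDeg C [a] - 1) := by
  rcases a with h | h
  · rw [letter, Sum.elim_inl, pathMap₁_gen]
    exact zero_mem _
  · rw [letter, Sum.elim_inr, pathMap₁_curv, Polynomial.coeff_neg]
    exact neg_mem (coeff_monomial_mem (gen_mem_grWords h) _ _)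

theorem pathMap₀_word_mem_degWords (l : List (C ⊕ C)) (n : ℕ) :
    (pathMap₀ C (word C l)).coeff n ∈ degWords C (wordDeg C l) := by
  induction l generalizing n with
  | nil =>
    rw [word_nil, pathMap₀_one]
    exact coeff_monomial_mem (word_mem_wordSpan (l := []) (by simp [wordDeg])) 0 n
  | cons a l ih =>
    rw [word_cons, pathMap₀_mul]
    exact coeff_mul_mem (fun x hx y hy => mul_mem_degWords (wordDeg_cons a l) hx hy)
      (fun n => grWords_le_degWords _ (pathMap₀_letter_mem a n)) ih n

theorem pathMap₀_word_mem (l : List (C ⊕ C)) (hl : l ≠ []) (n : ℕ) :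
    (pathMap₀ C (word C l)).coeff n ∈ grWords C Set.univ (wordDeg C l) := by
  rcases l with - | ⟨a, l⟩
  · exact absurd rfl hl
  rw [word_cons, pathMap₀_mul]
  exact coeff_mul_mem (fun x hx y hy => mul_mem_grWords_left (wordDeg_cons a l) hx hy)
    (pathMap₀_letter_mem a) (pathMap₀_word_mem_degWords l) n

theorem pathMap₁_word_mem (l : List (C ⊕ C)) (n : ℕ) :
    (pathMap₁ C (word C l)).coeff n ∈ grWords C Set.univ (wordDeg C l - 1) := by
  induction l generalizing n with
  | nil => simp [pathMap₁_one]
  | cons a l ih =>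
    rw [word_cons, pathMap₁_mul, Polynomial.coeff_add, ← wordDeg_cons]
    refine add_mem
      (coeff_mul_mem (fun x hx y hy => mul_mem_grWords_right (by ring) hx hy)
        (fun n => grWords_le_degWords _ (pathMap₀_letter_mem a n)) ih n)
      (coeff_mul_mem (fun x hx y hy => mul_mem_grWords_left (j := wordDeg C l) (by ring) hx hy)
        (pathMap₁_letter_mem a) (fun n => ?_) n)
    · rw [coeff_coeffMap]
      exact parity_mem (pathMap₀_word_mem_degWords l n)

/-- The contraction has degree `-1`. -/
theorem contraction_mem {k : ℤ} {x : T C} (hx : x ∈ grWords C Set.univ k) :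
    contraction C x ∈ grWords C Set.univ (k - 1) := by
  suffices grWords C Set.univ k ≤ (grWords C Set.univ (k - 1)).comap (contraction C) from this hx
  refine wordSpan_le.2 fun l hl => ?_
  rw [Submodule.mem_comap, contraction_apply]
  refine integral_mem (fun x hx => parity_mem hx) fun n => ?_
  have := pathMap₁_word_mem l n
  rwa [wordDeg_eq_bideg, hl.2.2] at this

/-- `H` is not multiplicative, but `k` is: it sends a commutator to a commutator of forms, whose
`dt`-coefficient is a combination of commutators of coefficients. Integration preserves these. -/
theorem contraction_comm_mem (u v : List (C ⊕ C)) (hu : u ≠ []) (hv : v ≠ []) :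
    contraction C (word C u * word C v - sgn (wordDeg C u * wordDeg C v) • (word C v * word C u)) ∈
      cycComm {p | 0 < p.1 + p.2} := by
  rw [contraction_apply]
  refine integral_mem (fun x hx => parity_mem_cycComm hx) fun n => ?_
  set i := wordDeg C u
  set j := wordDeg C v
  have h1 := coeff_comm_mem_cycComm (pathMap₀_word_mem u hu) (pathMap₁_word_mem v) n
  have h2 := coeff_comm_mem_cycComm (pathMap₁_word_mem u) (pathMap₀_word_mem v hv) n
  -- The sign `sgn j` in front of the second bracket comes from moving `dt` past the coefficients of
  -- `k(v)`.
  have e : pathMap₁ C (word C u * word C v - sgn (i * j) • (word C v * word C u)) =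
      (pathMap₀ C (word C u) * pathMap₁ C (word C v) -
        sgn (i * (j - 1)) • (pathMap₁ C (word C v) * pathMap₀ C (word C u))) +
      sgn j • (pathMap₁ C (word C u) * pathMap₀ C (word C v) -
        sgn ((i - 1) * j) • (pathMap₀ C (word C v) * pathMap₁ C (word C u))) := by
    have s1 : sgn (i * (j - 1)) = sgn (i * j) * sgn i := by
      rw [← sgn_add, show i * j + i = i * (j - 1) + 2 * i by ring, sgn_add, sgn_two_mul, mul_one]
    have s2 : sgn j * sgn ((i - 1) * j) = sgn (i * j) := by
      rw [← sgn_add]; congr 1; ring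
    rw [map_sub, map_zsmul, pathMap₁_mul, pathMap₁_mul,
      coeffMap_parity_of_mem (pathMap₀_word_mem u hu),
      coeffMap_parity_of_mem (pathMap₀_word_mem v hv), smul_sub, smul_smul, s2, s1]
    simp only [mul_smul_comm, smul_add, smul_smul]
    abel
  rw [e, Polynomial.coeff_add, Polynomial.coeff_smul]
  exact add_mem h1 (zsmul_mem h2 _)

theorem contraction_cyc_sub_mem {k : ℤ} {x : T C} (hx : x ∈ cycComm (atDeg Set.univ k)) :
    contraction C x ∈ cycComm (atDeg Set.univ (k - 1)) := by
  have hd := contraction_mem (cycComm_le _ hx)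
  have hc : contraction C x ∈ cycComm {p | 0 < p.1 + p.2} := by
    obtain ⟨y, hy, rfl⟩ := mem_cycComm.1 hx
    suffices grWords C Set.univ k ≤
        (cycComm {p | 0 < p.1 + p.2}).comap (contraction C ∘ₗ (cyc C - 1)) from this hy
    refine wordSpan_le.2 fun l hl => ?_
    rw [Submodule.mem_comap, LinearMap.comp_apply, LinearMap.sub_apply, Module.End.one_apply]
    rcases l with - | ⟨a, l⟩
    · exact absurd hl.2.1 (by simp)
    rw [cyc_word_cons]
    by_cases hl0 : l = []
    · subst hl0
      simp [wordDeg]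
    have := neg_mem (contraction_comm_mem [a] l (by simp) hl0)
    rw [← map_neg, neg_sub, ← word_append, ← word_append] at this
    exact this
  have := (wordSpan_inf_cycComm (C := C) _ _).le ⟨hd, hc⟩
  exact Submodule.map_mono (wordSpan_mono Set.inter_subset_right) this

/-! ### The Chern–Simons isomorphism -/

/-- The bidegrees of the words in `I^m`. -/
def curvSet (m : ℕ) : Set (ℕ × ℕ) := {p | m ≤ p.2}

theorem stepStable_univ : StepStable Set.univ := fun _ _ => Set.subset_univ _

theorem stepStable_empty : StepStable ∅ := fun _ hp => hp.elim

theorem stepStable_curvSet (m : ℕ) : StepStable (curvSet m) := by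
  rintro p hp q (⟨-, h⟩ | ⟨-, h⟩) <;> simp only [curvSet, Set.mem_ofPred_eq] at hp ⊢ <;> omega

end

/-! ### The complexes as spans of words, and the connecting map -/

variable {C : Type*} [AddCommGroup C] [Module ℂ C]

theorem gr_curvPow (n : ℕ) : gr C (curvPow C (n + 1)) = grWords C (curvSet (n + 1)) := by
  funext k
  rw [curvPow_succ_eq]
  exact gr_wordSpan _ _

theorem gr_weil : gr C (weil C) = grWords C Set.univ := by
  funext k
  rw [weil_eq, gr_wordSpan, grWords]
  congr 1
  ext p
  simp only [atDeg, Set.mem_inter_iff, Set.mem_ofPred_eq, Set.mem_univ]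
  tauto

theorem gr_bot : gr C ⊥ = grWords C ∅ := by
  funext k
  rw [gr, bot_inf_eq, grWords, atDeg, Set.empty_inter, wordSpan_empty]

theorem gr_cycComm (S : Set (ℕ × ℕ)) (k : ℤ) : gr C (cycComm S) k = cycComm (atDeg S k) := by
  rw [gr, inf_comm, weilDeg_eq, wordSpan_inf_cycComm]
  rfl

theorem grCyc_empty (S : Set (ℕ × ℕ)) (k : ℤ) : grCyc C S ∅ k = cycComm (atDeg S k) := by
  rw [grCyc, ← gr_bot, gr, bot_inf_eq, bot_sup_eq]

theorem gr_gradedComm_curvPow (n : ℕ) :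
    gr C (gradedComm C (curvPow C 1) (curvPow C n)) = grCyc C (curvSet (n + 1)) ∅ := by
  funext k
  rw [gradedComm_curvPow, gr_cycComm, grCyc_empty]
  congr 1
  ext p
  simp only [atDeg, curvSet, Set.mem_inter_iff, Set.mem_ofPred_eq]
  omega

theorem gr_sup_gradedComm_weil (n : ℕ) : gr C (curvPow C (n + 1) ⊔ gradedComm C (weil C) (weil C)) =
    grCyc C Set.univ (curvSet (n + 1)) := by
  funext k
  have e : ({p | 0 < p.1 + p.2} : Set (ℕ × ℕ)) ∩
      {p | 0 < p.1 + p.2 ∧ (p.1 : ℤ) + 2 * p.2 = k} = atDeg Set.univ k := by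
    ext p
    simp only [atDeg, Set.mem_inter_iff, Set.mem_ofPred_eq, Set.mem_univ]
    tauto
  rw [gradedComm_weil, curvPow_succ_eq, gr, weilDeg_eq]
  apply le_antisymm
  · rintro x ⟨hx, hk⟩
    obtain ⟨a, ha, c, hc, rfl⟩ := Submodule.mem_sup.1 hx
    -- Intersecting with a degree does not distribute over sums of subspaces in general; here the
    -- projection onto that degree preserves both summands.
    rw [← part_eq_self hk, map_add]
    refine Submodule.add_mem_sup (part_mem _ ha) ?_
    rw [← e]
    exact part_mem_cycComm _ hc
  · refine sup_le (le_inf (le_sup_of_le_left (wordSpan_mono Set.inter_subset_left))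
      (wordSpan_mono Set.inter_subset_right)) ?_
    rw [← e]
    exact le_inf (le_sup_of_le_right (Submodule.map_mono (wordSpan_mono Set.inter_subset_left)))
      ((cycComm_le _).trans (wordSpan_mono Set.inter_subset_right))

theorem cycComm_atDeg_mono {S R : Set (ℕ × ℕ)} (h : S ⊆ R) (k : ℤ) :
    (cycComm (atDeg S k) : Submodule ℂ (T C)) ≤ cycComm (atDeg R k) :=
  Submodule.map_mono (wordSpan_mono (Set.inter_subset_inter_left _ h))

theorem grWords_mono {S R : Set (ℕ × ℕ)} (h : S ⊆ R) (k : ℤ) : grWords C S k ≤ grWords C R k :=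
  wordSpan_mono (Set.inter_subset_inter_left _ h)

/-- Injectivity of `I_{n,♮} → W_♮`, the left end of the short exact sequence. -/
theorem mem_cycComm_of_mem_univ {S : Set (ℕ × ℕ)} {k : ℤ} {x : T C} (hx : x ∈ grWords C S k)
    (hc : x ∈ cycComm (atDeg Set.univ k)) : x ∈ cycComm (atDeg S k) := by
  have := (wordSpan_inf_cycComm (C := C) _ _).le ⟨hx, hc⟩
  exact Submodule.map_mono (wordSpan_mono Set.inter_subset_right) this

theorem cyc_sub_mem_cycComm {S : Set (ℕ × ℕ)} {x : T C} (hx : x ∈ wordSpan S) :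
    cyc C x - x ∈ cycComm S := mem_cycComm.2 ⟨x, hx, rfl⟩

variable [Coalgebra ℂ C]

theorem diff_cyc_sub_mem {k : ℤ} {w : T C} (hw : w ∈ grWords C Set.univ k) :
    diff C (cyc C w - w) ∈ cycComm (atDeg Set.univ (k + 1)) := by
  rw [← cyc_sub_diffB]
  exact cyc_sub_mem_cycComm (diffB_mem_atDeg stepStable_univ hw)

theorem contraction_mem_of_mem {S : Set (ℕ × ℕ)} {j : ℤ} {x : T C}
    (hx : x ∈ grWords C S (j + 1)) : contraction C x ∈ grWords C Set.univ j := by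
  simpa using contraction_mem (grWords_mono (Set.subset_univ S) _ hx)

theorem contraction_mem_cycComm {S : Set (ℕ × ℕ)} {j : ℤ} {x : T C}
    (hx : x ∈ cycComm (atDeg S (j + 1))) : contraction C x ∈ cycComm (atDeg Set.univ j) := by
  simpa using contraction_cyc_sub_mem (cycComm_atDeg_mono (Set.subset_univ S) _ hx)

theorem contraction_diff {S : Set (ℕ × ℕ)} {j : ℤ} {x : T C} (hx : x ∈ grWords C S j) :
    contraction C (diff C x) = x - diff C (contraction C x) :=
  eq_sub_of_add_eq (contraction_diff_add atDeg_pos hx)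

section Connecting

variable {R : Set (ℕ × ℕ)} {j : ℤ} {y w : T C}

/-- The connecting map: the differential of this element is `-∂ (t - 1) w`, a commutator in `W` that
lies in the ideal, hence a commutator of the ideal. -/
theorem diff_connecting_mem (hR : StepStable R) (hw : w ∈ grWords C Set.univ (j + 1))
    (ha : diff C y - (cyc C w - w) ∈ grWords C R (j + 1)) :
    diff C y - (cyc C w - w) ∈ cocycles (diff C) (grWords C R) (grCyc C R ∅) (j + 1) := by
  refine mem_cocycles.2 ⟨ha, ?_⟩
  rw [grCyc_empty]
  refine mem_cycComm_of_mem_univ (diff_mem_atDeg hR ha) ?_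
  rw [map_sub, diff_diff, zero_sub]
  exact neg_mem (diff_cyc_sub_mem hw)

/-- The Chern–Simons map undoes the connecting map: the difference is `-∂ H y - H (t - 1) w`. -/
theorem contraction_connecting_sub_mem (hy : y ∈ grWords C Set.univ j)
    (hw : w ∈ grWords C Set.univ (j + 1)) :
    contraction C (diff C y - (cyc C w - w)) - y ∈
      coboundaries (diff C) (grWords C Set.univ) (grCyc C Set.univ R) j := by
  refine mem_coboundaries.2 ⟨-contraction C y,
    neg_mem (contraction_mem_of_mem (S := Set.univ) (by rwa [sub_add_cancel])), ?_⟩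
  rw [map_sub, contraction_diff hy, map_neg]
  refine Submodule.mem_sup_right ?_
  convert neg_mem (contraction_mem_cycComm (cyc_sub_mem_cycComm hw)) using 1
  abel

end Connecting

theorem exists_isChernSimons (n : ℕ) (i j : ℤ) (h : j = i - 1) :
    ∃ φ : HI C n i ≃ₗ[ℂ] HW C n j, IsChernSimons C n i j φ.toLinearMap := by
  obtain rfl : i = j + 1 := by omega
  apply exists_equiv_induces <;>
    rw [gr_curvPow, gr_gradedComm_curvPow, gr_weil, gr_sup_gradedComm_weil]
  · intro x hx
    obtain ⟨hx, hdx⟩ := mem_cocycles.1 hx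
    rw [grCyc_empty] at hdx
    refine mem_cocycles.2 ⟨contraction_mem_of_mem hx, ?_⟩
    rw [← sub_sub_cancel x (diff C _), ← contraction_diff hx]
    exact sub_mem (Submodule.mem_sup_left hx)
      (Submodule.mem_sup_right (contraction_mem_cycComm hdx))
  · intro x _ hx
    obtain ⟨y, hy, hxy⟩ := mem_coboundaries.1 hx
    rw [add_sub_cancel_right] at hy
    rw [grCyc_empty] at hxy
    refine mem_coboundaries.2 ⟨-contraction C y,
      neg_mem (contraction_mem_of_mem (by rwa [sub_add_cancel])), ?_⟩
    have h1 := contraction_mem_cycComm hxy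
    rw [map_sub, contraction_diff hy] at h1
    rw [show contraction C x - diff C (-contraction C y) =
      y + (contraction C x - (y - diff C (contraction C y))) by rw [map_neg]; abel]
    exact add_mem (Submodule.mem_sup_left hy) (Submodule.mem_sup_right h1)
  · intro x hx hHx
    obtain ⟨hx, hdx⟩ := mem_cocycles.1 hx
    rw [grCyc_empty] at hdx
    obtain ⟨u, hu, hxu⟩ := mem_coboundaries.1 hHx
    obtain ⟨w, hw, ha⟩ := mem_grCyc.1 hxu
    -- The primitive is `a = H x - ∂u - (t - 1)w`, which lies in the ideal. Then `x - ∂a = H ∂x + ∂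
    -- (t - 1) w` is a commutator.
    refine mem_coboundaries.2 ⟨_, by rwa [add_sub_cancel_right], ?_⟩
    have hda := diff_mem_atDeg (stepStable_curvSet _) ha
    rw [grCyc_empty]
    refine mem_cycComm_of_mem_univ (sub_mem hx hda) ?_
    rw [map_sub, map_sub, diff_diff, sub_zero, sub_sub_eq_add_sub, add_sub_right_comm,
      ← contraction_diff hx]
    exact add_mem (contraction_mem_cycComm hdx) (diff_cyc_sub_mem hw)
  · rintro y ⟨hy, hdy⟩
    obtain ⟨w, hw, ha⟩ := mem_grCyc.1 hdy
    exact ⟨_, diff_connecting_mem (stepStable_curvSet _) hw ha,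
      contraction_connecting_sub_mem hy hw⟩

/-! ### The `S`-operators -/

theorem exists_isSOperator {A B J : Submodule ℂ (T C)} {S R : Set (ℕ × ℕ)}
    (hA : gr C A = grWords C S) (hB : gr C B = grCyc C S R) (hJ : gr C J = grWords C R)
    (hS : StepStable S) (hR : StepStable R) (k : ℤ) : ∃ s, IsSOperator C A B J k s := by
  unfold IsSOperator
  rw [hA, hB, hJ]
  choose ν hν using fun l => exists_augment_equiv (C := C) hS hR l
  obtain ⟨σ, hσ⟩ := exists_shift_induces (C := C) (S := S) (R := R) k
  exact ⟨(ν (k + 2)).symm.toLinearMap ∘ₗ σ ∘ₗ (ν k).toLinearMap, ν, σ, hν, hσ, fun α => by simp⟩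

/-- Describes `S` on representatives, without the inverse of the isomorphism induced by `N`. -/
theorem IsSOperator.cls_eq_iff {A B J : Submodule ℂ (T C)} {k : ℤ}
    {s : Coh (diff C) (gr C A) (gr C B) k →ₗ[ℂ] Coh (diff C) (gr C A) (gr C B) (k + 2)}
    (h : IsSOperator C A B J k s) (x : ↥(cocycles (diff C) (gr C A) (gr C B) k))
    (z : ↥(cocycles (diff C) (gr C A) (gr C B) (k + 2))) :
    Coh.cls _ _ _ _ z = s (Coh.cls _ _ _ _ x) ↔
      augment C z - shift C (augment C x) ∈
        coboundaries (totDiff C) (tot C (gr C A)) (tot C (gr C J)) (k + 2) := by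
  obtain ⟨ν, σ, hν, hσ, e⟩ := h
  obtain ⟨hz, ez⟩ := hν _ z
  obtain ⟨hx, ex⟩ := hν _ x
  obtain ⟨hx', ex'⟩ := hσ ⟨_, hx⟩
  rw [← (ν (k + 2)).injective.eq_iff, e]
  rw [LinearEquiv.coe_coe] at ez ex
  rw [ez, ex, ex', Coh.cls_eq_cls]

theorem chernSimons_comm_S {n : ℕ} {i j : ℤ} (h : j = i - 1)
    {φ : HI C n i →ₗ[ℂ] HW C n j} {ψ : HI C n (i + 2) →ₗ[ℂ] HW C n (j + 2)}
    {sI : HI C n i →ₗ[ℂ] HI C n (i + 2)} {sW : HW C n j →ₗ[ℂ] HW C n (j + 2)}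
    (hφ : IsChernSimons C n i j φ) (hψ : IsChernSimons C n (i + 2) (j + 2) ψ)
    (hI : IsSOperatorI C n i sI) (hW : IsSOperatorW C n j sW) (α : HI C n i) :
    ψ (sI α) = sW (φ α) := by
  obtain rfl : i = j + 1 := by omega
  obtain ⟨x, rfl⟩ := Coh.cls_surjective α
  obtain ⟨hy, ey⟩ := hφ x
  rw [ey]
  -- The comparison starts on the side of `W_n`: `z` represents `S [H x]`, and its connecting
  -- cocycle `a` will represent `S [x]`.
  obtain ⟨z, hz⟩ := Coh.cls_surjective (sW (Coh.cls _ _ _ _ ⟨_, hy⟩))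
  obtain ⟨u, hu, hzu⟩ := mem_coboundaries.1 ((hW.cls_eq_iff _ _).1 hz)
  obtain ⟨z, hz'⟩ := z
  obtain ⟨x, hx'⟩ := x
  rw [← hz]
  clear ey hz
  dsimp only at hzu ⊢
  have hx := hx'
  have hz := hz'
  rw [gr_curvPow, gr_gradedComm_curvPow] at hx
  rw [gr_weil, gr_sup_gradedComm_weil] at hz
  rw [gr_curvPow] at hzu
  obtain ⟨hx, hdx⟩ := mem_cocycles.1 hx
  rw [grCyc_empty] at hdx
  obtain ⟨w, hw, ha⟩ := mem_grCyc.1 hz.2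
  have ha' := diff_connecting_mem (stepStable_curvSet (n + 1)) hw ha
  have hza := contraction_connecting_sub_mem (R := curvSet (n + 1)) hz.1 hw
  set a := diff C z - (cyc C w - w) with ha_def
  rw [← gr_curvPow, ← gr_gradedComm_curvPow, add_right_comm j 2 1] at ha'
  rw [← gr_weil, ← gr_sup_gradedComm_weil] at hza
  have key : Coh.cls _ _ _ _ ⟨a, ha'⟩ = sI (Coh.cls _ _ _ _ ⟨x, hx'⟩) := by
    -- The primitive is the error term `N z - shift (N (H x)) - D u`, whose entries lie in
    -- `I^{n+1}`. Nothing is divided out in the bicomplex of `I_n`, so its differential must equal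
    -- `N a - shift (N x)` exactly.
    refine (hI.cls_eq_iff _ _).2 (mem_coboundaries.2
      ⟨_, by rwa [show j + 1 + 2 - 1 = j + 2 by ring, gr_curvPow], ?_⟩)
    convert (tot C (gr C ⊥) (j + 1 + 2)).zero_mem using 1
    have h1 : augment C a = augment C (diff C z) := by
      simp [augment, ha_def, cycNorm_cyc]
    -- `x` and `∂ H x` differ by `H ∂ x`, an element in the image of `t - 1`, which `N` kills.
    have h2 : augment C (diff C (contraction C x)) = augment C x := by
      obtain ⟨v, -, hv⟩ := mem_cycComm.1 (contraction_mem_cycComm hdx)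
      rw [contraction_diff hx, eq_sub_iff_add_eq, ← eq_sub_iff_add_eq'] at hv
      simp [augment, hv, cycNorm_cyc]
    rw [h1, (totDiff C).map_sub, (totDiff C).map_sub, totDiff_totDiff, totDiff_shift,
      totDiff_augment, totDiff_augment, h2, sub_zero]
    exact sub_self _
  rw [← key]
  obtain ⟨hHa, eHa⟩ := hψ ⟨a, ha'⟩
  rw [eHa, Coh.cls_eq_cls]
  exact hza

end NCWeil

end

open NCWeil in
/-- The Chern–Simons map induces isomorphisms `H^i(I_n(C)_♮) ≅ H^{i-1}(W_n(C)_♮)`, and they commute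
with the `S`-operators. -/
theorem theorem6p3 (C : Type*) [AddCommGroup C] [Module ℂ C] [Coalgebra ℂ C] (n : ℕ) :
    ∃ (CS : ∀ i j : ℤ, j = i - 1 → (HI C n i ≃ₗ[ℂ] HW C n j))
      (SI : ∀ i : ℤ, HI C n i →ₗ[ℂ] HI C n (i + 2))
      (SW : ∀ j : ℤ, HW C n j →ₗ[ℂ] HW C n (j + 2)),
      (∀ (i j : ℤ) (h : j = i - 1), IsChernSimons C n i j (CS i j h).toLinearMap) ∧
      (∀ i : ℤ, IsSOperatorI C n i (SI i)) ∧
      (∀ j : ℤ, IsSOperatorW C n j (SW j)) ∧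
      ∀ (i j : ℤ) (h : j = i - 1) (α : HI C n i),
        CS (i + 2) (j + 2) (by omega) (SI i α) = SW j (CS i j h α) := by
  choose CS hCS using exists_isChernSimons (C := C) n
  choose SI hSI using fun i => exists_isSOperator (gr_curvPow (C := C) n)
    (gr_gradedComm_curvPow n) gr_bot (stepStable_curvSet _) stepStable_empty i
  choose SW hSW using fun j => exists_isSOperator (gr_weil (C := C))
    (gr_sup_gradedComm_weil n) (gr_curvPow n) stepStable_univ (stepStable_curvSet _) j
  exact ⟨CS, SI, SW, hCS, hSI, hSW, fun i j h α =>
    chernSimons_comm_S h (hCS i j h) (hCS (i + 2) (j + 2) (by omega)) (hSI i) (hSW j) α⟩
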